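/- \textbf{Game.} There are $N$ players; player $i$ chooses $x_i\in\mathcal X_i\subseteq\mathbb R^{n_i}$; put $n=\sum_i n_i$, $x=[x_1;\dots;x_N]$, $\mathcal X=\prod_i\mathcal X_i$. With $A_i\in\mathbb R^{m\times n_i}$, $A=[A_1,\dots,A_N]$ and $c\in\mathbb R^m$, the collective feasible set is $\tilde{\mathcal X}=\{x\in\mathcal X: Ax\le c\}$. Player $i$ minimizes $\mathbb J_i(x_i;x_{-i})=\mathbb E[J_i(x_i;x_{-i},\xi_i)]$, where $\xi_i:\Omega_i\to\mathbb R^{n_{\xi_i}}$ is a random vector, $J_i$ is real-valued and the expectations exist for all $x\in\mathbb R^n$. Let $\partial_{x_i}\mathbb J_i$ be the convex subdifferential with respect to $x_i$. A point $x^*\in\tilde{\mathcal X}$ is a \emph{v-SGNE} if there is $g^*\in\prod_i\partial_{x_i}\mathbb J_i(x_i^*;x_{-i}^*)$ with $(x-x^*)^Tg^*\ge0$ for all $x\in\tilde{\mathcal X}$. A pair $(x^*,\lambda^*)$ satisfies the \emph{KKT conditions} if $0\in\partial_{x_i}\mathbb J_i(x_i^*;x_{-i}^*)+A_i^T\lambda^*+N_{\mathcal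 X_i}(x_i^*)$ for all $i$ and $0\in-(Ax^*-c)+N_{\mathbb R^m_+}(\lambda^*)$, where $N_S$ is the normal cone. \textbf{Network and operators.} The players are the nodes of a communication graph whose edges carry an orientation; $E_g$ is the number of edges, $B\in\mathbb R^{N\times E_g}$ the incidence matrix ($+1$ at the head, $-1$ at the tail of an edge), $L=BB^T$, and $B_q=B\otimes I_q$, $L_q=L\otimes I_q$ for $q\in\{n,m\}$. Let $\psi=[\boldsymbol y;\boldsymbol\lambda;\boldsymbol\mu;\boldsymbol z]$ with $\boldsymbol y=[y_i]_i\in\mathbb R^{nN}$ (where $y_i=[y_i^j]_j\in\mathbb R^n$ and $y_i^j$ is the estimate by player $i$ of the decision of player $j$), $\boldsymbol\lambda\in\mathbb R^{mN}$, $\boldsymbol\mu\in\mathbb R^{nE_g}$, $\boldsymbol z\in\mathbb R^{mE_g}$. Let $\mathcal R\boldsymbol y=[y_i^i]_i$, $\Lambda=\mathrm{blkdiag}(A_1,\dots,A_N)$, $\boldsymbol c=[c_i]_i$ with $\sum_ic_i=c$; let $\mathbb F(x)=\prod_i\partial_{x_i}\mathbb J_i(x_i;x_{-i})$ be the pseudogradient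 and $\hat{\mathbb F}(\boldsymbol y)=\prod_i\partial_{y_i^i}\mathbb J_i(y_i^i;y_i^{-i})$ the extended pseudogradient. Let $\hat{\mathcal X}=\{\boldsymbol y:y_i^i\in\mathcal X_i\ \forall i\}$ and $\hat{\mathcal X}^B=\{\boldsymbol y:y_i^i\in\mathcal X_i^B\ \forall i\}$ with bounded closed boxes $\mathcal X_i^B\supseteq\mathcal X_i$. For weights $\rho_\mu,\rho_z\ge0$ define $$\mathbb T\psi=\begin{bmatrix}\mathcal R^T(\hat{\mathbb F}(\boldsymbol y)+\Lambda^T\boldsymbol\lambda)+B_n\boldsymbol\mu+\rho_\mu L_n\boldsymbol y+N_{\hat{\mathcal X}}(\boldsymbol y)\\ N_{\mathbb R^{mN}_+}(\boldsymbol\lambda)-\Lambda\mathcal R\boldsymbol y+\boldsymbol c+B_m\boldsymbol z+\rho_zL_m\boldsymbol\lambda\\-B_n^T\boldsymbol y\\-B_m^T\boldsymbol\lambda\end{bmatrix},\qquad D=\begin{bmatrix}\frac{\rho_\mu}2L_n&\frac12(\Lambda\mathcal R)^T&\frac12B_n&0\\-\frac12\Lambda\mathcal R&\frac{\rho_z}2L_m&0&\frac12B_m\\-\frac12B_n^T&0&0&0\\0&-\frac12B_m^T&0&0\end{bmatrix},$$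 $$\mathbb A\psi=D\psi+\begin{bmatrix}\mathcal R^T\hat{\mathbb F}(\boldsymbol y)+N_{\hat{\mathcal X}^B}(\boldsymbol y)\\\boldsymbol c\\0\\0\end{bmatrix},\qquad\mathcal B\psi=D\psi+\begin{bmatrix}N_{\hat{\mathcal X}}(\boldsymbol y)\\N_{\mathbb R^{mN}_+}(\boldsymbol\lambda)\\0\\0\end{bmatrix},$$ $$\Phi=\begin{bmatrix}\boldsymbol\tau_1^{-1}-\frac{\rho_\mu}2L_n&-\frac12(\Lambda\mathcal R)^T&-\frac12B_n&0\\-\frac12\Lambda\mathcal R&\boldsymbol\tau_2^{-1}-\frac{\rho_z}2L_m&0&-\frac12B_m\\-\frac12B_n^T&0&\boldsymbol\tau_3^{-1}&0\\0&-\frac12B_m^T&0&\boldsymbol\tau_4^{-1}\end{bmatrix},$$ where each $\boldsymbol\tau_s$ is block diagonal with a positive multiple of the identity for every player ($s=1,2$) or edge ($s=3,4$). Put $\|\psi\|_{\mathcal K}=(\psi^T\Phi\psi)^{1/2}$, $\bar{\mathbb A}=\Phi^{-1}\mathbb A$, $\bar{\mathcal B}=\Phi^{-1}\mathcal B$, $J_S=(\mathrm{Id}+S)^{-1}$,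 $R_S=2J_S-\mathrm{Id}$ and $\mathscr R_*=R_{\bar{\mathcal B}}\circ R_{\bar{\mathbb A}}$. \textbf{Assumptions.} (1) For each $i$ and each $\omega_i\in\Omega_i$, $J_i(\cdot;\cdot,\xi_i(\omega_i))$ is continuous, and it is convex in $x_i$ for every $x_{-i}$. (2) Each $\mathcal X_i$ is nonempty, compact and convex, $\tilde{\mathcal X}$ is nonempty, and the Mangasarian--Fromovitz constraint qualification holds: at every $x\in\tilde{\mathcal X}$ there is $h$ in the tangent cone of $\mathcal X$ at $x$ with $(Ah)_l<0$ for every $l$ with $(Ax)_l=c_l$. (3) A v-SGNE exists. (4) The communication graph is connected (disregarding the orientation of its edges) and has no self-loops. (5) At least one of the following holds: (i) $\mathcal R^T\hat{\mathbb F}+\frac{\rho_\mu}2L_n$ is maximally monotone; (ii) $\mathbb F$ is strongly monotone with constant $\eta>0$ and Lipschitz with constant $\theta_1>0$ on $\mathbb R^n$, $\hat{\mathbb F}$ is Lipschitz with constant $\theta_2>0$ on $\mathbb R^{nN}$, and $\rho_\mu\ge\frac2{\sigma_1}\bigl(\frac{(\theta_1+\theta_2)^2}{4\eta}+\theta_2\bigr)$,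 where $\sigma_1$ is the smallest positive eigenvalue of $L$ (no condition on $\rho_\mu$ if $N=1$). (6) $\Phi$ is positive definite. \textbf{Theorem.} Let Assumptions (1)--(6) hold. Let $\gamma^{(k)}\in[0,1]$, $k\in\mathbb N$, with $\sum_k\gamma^{(k)}(1-\gamma^{(k)})=+\infty$. On a probability space, let $\tilde\psi^{(0)}$ be a random point and $\xi_i^{(k)}$ the finite family of noise samples observed by player $i$ in iteration $k$; let $\mathcal F_k$ be the $\sigma$-field generated by $\tilde\psi^{(0)}$ and the $\xi_i^{(l)}$ with $l<k$ and all $i$. Let $\tilde\psi^{(k+1)}=\tilde\psi^{(k)}+\gamma^{(k)}(\mathscr R^{(k)}\tilde\psi^{(k)}-\tilde\psi^{(k)})$, where $\mathscr R^{(k)}=R_{\bar{\mathcal B}}\circ\tilde R^{(k)}$ and $\tilde R^{(k)}$ is any (measurable) approximation of $R_{\bar{\mathbb A}}$, which depends on the samples $(\xi_i^{(k)})_i$. Put $\varepsilon^{(k)}=\|\mathscr R^{(k)}\tilde\psi^{(k)}-\mathscr R_*\tilde\psi^{(k)}\|_{\mathcal K}$. Suppose that (i) $(\|\tilde\psi^{(k)}\|_{\mathcal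 K})_k$ is bounded a.s. and (ii) $\sum_k\gamma^{(k)}\,\mathbb E[\varepsilon^{(k)}\mid\mathcal F_k]<\infty$ a.s. Then $J_{\bar{\mathbb A}}$ and $J_{\bar{\mathcal B}}$ are single-valued and defined everywhere; $\tilde\psi^{(k)}$ converges a.s. to a fixed point of $\mathscr R_*$; and $J_{\bar{\mathbb A}}(\tilde\psi^{(k)})$ converges a.s. to a zero $\psi^*=[\boldsymbol y^*;\boldsymbol\lambda^*;\boldsymbol\mu^*;\boldsymbol z^*]$ of $\mathbb T$ with $\boldsymbol y^*=\boldsymbol 1_N\otimes y^*$ and $\boldsymbol\lambda^*=\boldsymbol 1_N\otimes\lambda^*$, where $y^*$ is a v-SGNE and $(y^*,\lambda^*)$ satisfies the KKT conditions. -/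

import Mathlib

open MeasureTheory Filter Topology
open scoped ENNReal Matrix

universe u

noncomputable section

namespace SGNEP

/-! ### Generic notions for set-valued operators

Vectors are stored blockwise, and the Euclidean inner product of each block space is passed to the
generic definitions as a pairing `ip`. -/

/-- Euclidean inner product of two families of real vectors. -/
def blockInner {ι : Type*} [Fintype ι] {κ : ι → Type*} [∀ i, Fintype (κ i)]
    (x y : ∀ i, κ i → ℝ) : ℝ :=
  ∑ i, x i ⬝ᵥ y i

/-- Euclidean inner product of two families (indexed by `ι`) of families of real vectors. -/
def stackInner {ι : Type*} [Fintype ι] {κ : Type*} [Fintype κ] {σ : κ → Type*}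
    [∀ j, Fintype (σ j)] (x y : ι → ∀ j, σ j → ℝ) : ℝ :=
  ∑ i, blockInner (x i) (y i)

/-- Normal cone to `S` at `x` (empty when `x ∉ S`). -/
def normalCone {V : Type*} [AddCommGroup V] (ip : V → V → ℝ) (S : Set V) (x : V) : Set V :=
  {w | x ∈ S ∧ ∀ z ∈ S, ip w (z - x) ≤ 0}

/-- Maximal monotonicity of a set-valued operator. -/
def IsMaximallyMonotone {V : Type*} [AddCommGroup V] (ip : V → V → ℝ) (T : V → Set V) : Prop :=
  (∀ x x' w w', w ∈ T x → w' ∈ T x' → 0 ≤ ip (x - x') (w - w')) ∧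
  ∀ x w, (∀ x' w', w' ∈ T x' → 0 ≤ ip (x - x') (w - w')) → w ∈ T x

/-- The set of values of the resolvent `(Id + T)⁻¹` at `x`. -/
def resolventSet {V : Type*} [AddCommGroup V] (T : V → Set V) (x : V) : Set V :=
  {p | x - p ∈ T p}

/-- The resolvent as a function: a value of `(Id + T)⁻¹` at `x`. That there is exactly one value
is stated separately. -/
def resolvent {V : Type*} [AddCommGroup V] (T : V → Set V) (x : V) : V :=
  Classical.epsilon fun p => p ∈ resolventSet T x

/-- Reflected resolvent `2 (Id + T)⁻¹ - Id`. -/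
def reflectedResolvent {V : Type*} [AddCommGroup V] (T : V → Set V) (x : V) : V :=
  (2 : ℕ) • resolvent T x - x

/-- The map `M ⊗ I` acting on a stack of vectors. -/
def kron {ι κ : Type*} [Fintype κ] {V : Type*} [AddCommGroup V] [Module ℝ V]
    (M : Matrix ι κ ℝ) (v : κ → V) : ι → V :=
  fun i => ∑ k, M i k • v k

/-! ### The game -/

/-- The data of a stochastic generalized Nash equilibrium problem with `N` players and `m` shared
affine constraints on a communication network. -/
structure Game (N m : ℕ) where
  /-- dimension of the decision of each player -/
  n : Fin N → ℕ
  /-- local feasible sets -/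
  X : ∀ i, Set (Fin (n i) → ℝ)
  /-- blocks of the coupling constraint -/
  A : ∀ i, Matrix (Fin m) (Fin (n i)) ℝ
  /-- available resources -/
  c : Fin m → ℝ
  /-- dimension of the noise of each player -/
  d : Fin N → ℕ
  /-- sample spaces of the noises -/
  Ω : Fin N → Type u
  /-- their sigma-algebras -/
  [mΩ : ∀ i, MeasurableSpace (Ω i)]
  /-- their probability measures -/
  P : ∀ i, Measure (Ω i)
  prob : ∀ i, IsProbabilityMeasure (P i)
  /-- the noises -/
  ξ : ∀ i, Ω i → (Fin (d i) → ℝ)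
  measurable_ξ : ∀ i, Measurable (ξ i)
  /-- scenario-based objectives: `J i x s` with `x` the decisions of all players, `s` the noise -/
  J : ∀ i, (∀ j, Fin (n j) → ℝ) → (Fin (d i) → ℝ) → ℝ
  /-- communication links, each with an orientation: `(i, j)` has tail `i` and head `j` -/
  edges : Finset (Fin N × Fin N)

attribute [instance] Game.mΩ

variable {N m : ℕ}

namespace Game

variable (G : Game.{u} N m)

/-- Collective decisions `x = (x_1, …, x_N)`. -/
abbrev Profile : Type := ∀ i, Fin (G.n i) → ℝ

/-- Edges. -/
abbrev Edge : Type := {e : Fin N × Fin N // e ∈ G.edges}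

/-- Stacks `𝐲 = (y_1, …, y_N)`; `y i j` is the estimate by player `i` of the decision of `j`. -/
abbrev Stack : Type := Fin N → G.Profile

/-- The space of all `ψ = (𝐲, 𝛌, 𝛍, 𝐳)`. -/
abbrev Pt : Type :=
  G.Stack × (Fin N → Fin m → ℝ) × (G.Edge → G.Profile) × (G.Edge → Fin m → ℝ)

/-- Euclidean inner product on the space of all `ψ`. -/
def ptInner (p q : G.Pt) : ℝ :=
  stackInner p.1 q.1 + blockInner p.2.1 q.2.1 + stackInner p.2.2.1 q.2.2.1
    + blockInner p.2.2.2 q.2.2.2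

/-- `∑ i, A_i x_i`. -/
def coupling (x : G.Profile) : Fin m → ℝ := ∑ i, G.A i *ᵥ x i

/-- The product of the local feasible sets. -/
def prodX : Set G.Profile := {x | ∀ i, x i ∈ G.X i}

/-- The collective feasible set. -/
def feasible : Set G.Profile := {x | x ∈ G.prodX ∧ ∀ l, G.coupling x l ≤ G.c l}

/-- Expected-value objective of player `i`. -/
def expJ (i : Fin N) (x : G.Profile) : ℝ :=
  ∫ ω, G.J i x (G.ξ i ω) ∂(G.P i)

/-- Partial subdifferential of the expected-value objective of player `i` with respect to the
decision of player `i`. -/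
def partialSubdiff (i : Fin N) (x : G.Profile) : Set (Fin (G.n i) → ℝ) :=
  {g | ∀ v, G.expJ i x + g ⬝ᵥ (v - x i) ≤ G.expJ i (Function.update x i v)}

/-- Pseudogradient. -/
def pseudograd (x : G.Profile) : Set G.Profile := {g | ∀ i, g i ∈ G.partialSubdiff i x}

/-- Extended pseudogradient. -/
def extPseudograd (y : G.Stack) : Set G.Profile := {g | ∀ i, g i ∈ G.partialSubdiff i (y i)}

/-- Variational stochastic generalized Nash equilibrium. -/
def IsVSGNE (x : G.Profile) : Prop :=
  x ∈ G.feasible ∧ ∃ g ∈ G.pseudograd x, ∀ x' ∈ G.feasible, 0 ≤ blockInner (x' - x) g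

/-- The KKT system of the variational problem, with a multiplier common to all players. -/
def IsKKT (x : G.Profile) (lam : Fin m → ℝ) : Prop :=
  (∀ i, ∃ g ∈ G.partialSubdiff i x, ∃ w ∈ normalCone dotProduct (G.X i) (x i),
    g + (G.A i)ᵀ *ᵥ lam + w = 0) ∧
  ∃ w ∈ normalCone dotProduct {l : Fin m → ℝ | ∀ a, 0 ≤ l a} lam, -(G.coupling x - G.c) + w = 0

/-! ### The network operators -/

/-- Incidence matrix: `+1` at the head and `-1` at the tail of an edge. -/
def incidence : Matrix (Fin N) G.Edge ℝ :=
  fun i e => (if e.1.2 = i then 1 else 0) - (if e.1.1 = i then 1 else 0)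

/-- Laplacian matrix. -/
def laplacian : Matrix (Fin N) (Fin N) ℝ := G.incidence * G.incidenceᵀ

/-- The map `𝓡ᵀ`: it puts the block `v i` at the position of the own decision of player `i`. -/
def selT (v : G.Profile) : G.Stack := fun i => Pi.single i (v i)

/-- The map `Λ𝓡`. -/
def ΛR (y : G.Stack) : Fin N → Fin m → ℝ := fun i => G.A i *ᵥ y i i

/-- The map `(Λ𝓡)ᵀ = 𝓡ᵀΛᵀ`. -/
def ΛRT (l : Fin N → Fin m → ℝ) : G.Stack := G.selT fun i => (G.A i)ᵀ *ᵥ l i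

/-- The extended set: player `i` has `y i i ∈ S i`, its estimates of the others are free. -/
def extSet (S : ∀ i, Set (Fin (G.n i) → ℝ)) : Set G.Stack := {y | ∀ i, y i i ∈ S i}

/-- The nonnegative orthant for the stacked multipliers. -/
def nonnegDual (N m : ℕ) : Set (Fin N → Fin m → ℝ) := {l | ∀ i a, 0 ≤ l i a}

end Game

/-- Parameters of the algorithm. -/
structure Params (G : Game.{u} N m) where
  /-- consensus weight for the decisions -/
  ρμ : ℝ
  /-- consensus weight for the multipliers -/
  ρz : ℝ
  /-- step sizes -/
  τ₁ : Fin N → ℝ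
  τ₂ : Fin N → ℝ
  τ₃ : G.Edge → ℝ
  τ₄ : G.Edge → ℝ
  /-- local shares of the resources -/
  cLoc : Fin N → Fin m → ℝ
  /-- lower and upper corners of the bounded boxes -/
  lo : ∀ i, Fin (G.n i) → ℝ
  hi : ∀ i, Fin (G.n i) → ℝ

namespace Params

variable {G : Game.{u} N m} (p : Params G)

/-- What is required of the parameters at their introduction. -/
structure Admissible : Prop where
  ρμ_nonneg : 0 ≤ p.ρμ
  ρz_nonneg : 0 ≤ p.ρz
  τ₁_pos : ∀ i, 0 < p.τ₁ i
  τ₂_pos : ∀ i, 0 < p.τ₂ i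
  τ₃_pos : ∀ e, 0 < p.τ₃ e
  τ₄_pos : ∀ e, 0 < p.τ₄ e
  sum_cLoc : ∑ i, p.cLoc i = G.c
  subset_box : ∀ i, G.X i ⊆ Set.Icc (p.lo i) (p.hi i)

/-- The operator `𝕋` whose zeros are sought. -/
def opT (ψ : G.Pt) : Set G.Pt :=
  {w | ∃ g ∈ G.extPseudograd ψ.1,
    ∃ u ∈ normalCone stackInner (G.extSet G.X) ψ.1,
    ∃ v ∈ normalCone blockInner (Game.nonnegDual N m) ψ.2.1,
    w = (G.selT g + G.ΛRT ψ.2.1 + kron G.incidence ψ.2.2.1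
            + p.ρμ • kron G.laplacian ψ.1 + u,
         v - G.ΛR ψ.1 + p.cLoc + kron G.incidence ψ.2.2.2 + p.ρz • kron G.laplacian ψ.2.1,
         -kron G.incidenceᵀ ψ.1,
         -kron G.incidenceᵀ ψ.2.1)}

/-- The linear part `D` shared by the two operators of the splitting. -/
def opD (ψ : G.Pt) : G.Pt :=
  ((p.ρμ / 2) • kron G.laplacian ψ.1 + (1 / 2 : ℝ) • G.ΛRT ψ.2.1
      + (1 / 2 : ℝ) • kron G.incidence ψ.2.2.1,
   -(1 / 2 : ℝ) • G.ΛR ψ.1 + (p.ρz / 2) • kron G.laplacian ψ.2.1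
      + (1 / 2 : ℝ) • kron G.incidence ψ.2.2.2,
   -(1 / 2 : ℝ) • kron G.incidenceᵀ ψ.1,
   -(1 / 2 : ℝ) • kron G.incidenceᵀ ψ.2.1)

/-- The operator `𝔸`, with the normal cone of the extended box set. -/
def opA (ψ : G.Pt) : Set G.Pt :=
  {w | ∃ g ∈ G.extPseudograd ψ.1,
    ∃ u ∈ normalCone stackInner (G.extSet fun i => Set.Icc (p.lo i) (p.hi i)) ψ.1,
    w = p.opD ψ + (G.selT g + u, p.cLoc, 0, 0)}

/-- The operator `𝓑`. -/
def opB (ψ : G.Pt) : Set G.Pt :=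
  {w | ∃ u ∈ normalCone stackInner (G.extSet G.X) ψ.1,
    ∃ v ∈ normalCone blockInner (Game.nonnegDual N m) ψ.2.1,
    w = p.opD ψ + (u, v, 0, 0)}

/-- The design matrix `Φ`, as a linear map given by its blocks. -/
def Φ (ψ : G.Pt) : G.Pt :=
  ((fun i => (p.τ₁ i)⁻¹ • ψ.1 i) - (p.ρμ / 2) • kron G.laplacian ψ.1
      - (1 / 2 : ℝ) • G.ΛRT ψ.2.1 - (1 / 2 : ℝ) • kron G.incidence ψ.2.2.1,
   -(1 / 2 : ℝ) • G.ΛR ψ.1 + (fun i => (p.τ₂ i)⁻¹ • ψ.2.1 i)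
      - (p.ρz / 2) • kron G.laplacian ψ.2.1 - (1 / 2 : ℝ) • kron G.incidence ψ.2.2.2,
   -(1 / 2 : ℝ) • kron G.incidenceᵀ ψ.1 + (fun e => (p.τ₃ e)⁻¹ • ψ.2.2.1 e),
   -(1 / 2 : ℝ) • kron G.incidenceᵀ ψ.2.1 + (fun e => (p.τ₄ e)⁻¹ • ψ.2.2.2 e))

/-- The norm of the inner product `⟨ψ, ψ'⟩ = ψᵀ Φ ψ'`. -/
def normK (ψ : G.Pt) : ℝ := √(G.ptInner ψ (p.Φ ψ))

/-- `Φ⁻¹𝔸`: the values are the preimages under `Φ` of the values of `𝔸`. -/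
def pA (ψ : G.Pt) : Set G.Pt := p.Φ ⁻¹' p.opA ψ

/-- `Φ⁻¹𝓑`. -/
def pB (ψ : G.Pt) : Set G.Pt := p.Φ ⁻¹' p.opB ψ

/-- The exact Douglas–Rachford operator: the reflected resolvent of `Φ⁻¹𝔸` followed by that of
`Φ⁻¹𝓑`. -/
def Rstar (ψ : G.Pt) : G.Pt := reflectedResolvent p.pB (reflectedResolvent p.pA ψ)

end Params

/-! ### Standing assumptions -/

/-- Scenario-based objectives: continuous in the decisions and convex in the own decision for every
sample; the expectations exist. -/
structure ScenarioObjectives (G : Game.{u} N m) : Prop where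
  continuous : ∀ i ω, Continuous fun x : G.Profile => G.J i x (G.ξ i ω)
  convex : ∀ i ω (x : G.Profile),
    ConvexOn ℝ Set.univ fun v => G.J i (Function.update x i v) (G.ξ i ω)
  integrable : ∀ i (x : G.Profile),
    Integrable (fun ω => G.J i x (G.ξ i ω)) (G.P i)

/-- Feasible sets, with the Mangasarian–Fromovitz constraint qualification: at every feasible point
some tangent direction of the local sets strictly decreases every active shared constraint. -/
structure FeasibleSets (G : Game.{u} N m) : Prop where
  nonempty : ∀ i, (G.X i).Nonempty
  compact : ∀ i, IsCompact (G.X i)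
  convex : ∀ i, Convex ℝ (G.X i)
  feasible_nonempty : G.feasible.Nonempty
  mfcq : ∀ x ∈ G.feasible, ∃ h ∈ posTangentConeAt G.prodX x,
    ∀ l, G.coupling x l = G.c l → G.coupling h l < 0

/-- Communicability: no self-loops, and the graph is connected when the orientations of the links
are forgotten. -/
structure Communicable (G : Game.{u} N m) : Prop where
  no_loop : ∀ e ∈ G.edges, e.1 ≠ e.2
  connected : (SimpleGraph.fromRel fun i j => (i, j) ∈ G.edges).Connected

/-- First alternative: `𝓡ᵀ𝔽 + (ρμ/2) L_n` is maximally monotone. -/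
def ConvgMonotone {G : Game.{u} N m} (p : Params G) : Prop :=
  IsMaximallyMonotone stackInner fun y : G.Stack =>
    {w | ∃ g ∈ G.extPseudograd y, w = G.selT g + (p.ρμ / 2) • kron G.laplacian y}

/-- Second alternative: the pseudogradient is strongly monotone and Lipschitz, the extended
pseudogradient is Lipschitz, and `ρμ` is large compared with the smallest positive eigenvalue of the
Laplacian (for a single player there is no such eigenvalue, and no condition). -/
def ConvgLipschitz {G : Game.{u} N m} (p : Params G) : Prop :=
  ∃ η θ₁ θ₂ : ℝ, 0 < η ∧ 0 < θ₁ ∧ 0 < θ₂ ∧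
    (∀ x x' : G.Profile, ∀ g ∈ G.pseudograd x, ∀ g' ∈ G.pseudograd x',
      η * blockInner (x - x') (x - x') ≤ blockInner (x - x') (g - g') ∧
      √(blockInner (g - g') (g - g')) ≤ θ₁ * √(blockInner (x - x') (x - x'))) ∧
    (∀ y y' : G.Stack, ∀ g ∈ G.extPseudograd y, ∀ g' ∈ G.extPseudograd y',
      √(blockInner (g - g') (g - g')) ≤ θ₂ * √(stackInner (y - y') (y - y'))) ∧
    ∀ σ₁ : ℝ, IsLeast {s : ℝ | 0 < s ∧ Module.End.HasEigenvalue (Matrix.toLin' G.laplacian) s} σ₁ →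
      2 / σ₁ * ((θ₁ + θ₂) ^ 2 / (4 * η) + θ₂) ≤ p.ρμ

/-- Positive definiteness of the (symmetric) design matrix. -/
def DesignPosDef {G : Game.{u} N m} (p : Params G) : Prop :=
  ∀ ψ : G.Pt, ψ ≠ 0 → 0 < G.ptInner ψ (p.Φ ψ)

/-- The sigma-algebra generated by the initial point and by the noise samples that the players
observe in the iterations before `k`; player `i` observes `K l i` samples in iteration `l`. -/
@[reducible] def history {G : Game.{u} N m} {Ω : Type*} (K : ℕ → Fin N → ℕ) (ψ₀ : Ω → G.Pt)
    (ζ : ∀ l i, Fin (K l i) → Ω → (Fin (G.d i) → ℝ)) (k : ℕ) : MeasurableSpace Ω :=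
  MeasurableSpace.comap ψ₀ inferInstance ⊔
    ⨆ l : Fin k, ⨆ i, ⨆ t, MeasurableSpace.comap (ζ l i t) inferInstance

end SGNEP

end

namespace SGNEP

/-! ### Convex analysis in coordinate space -/

/-! The iteration is an inexact Krasnosel'skii–Mann iteration of `Rstar`, studied path by path in
the Euclidean metric of `Φ`. Four facts carry the proof.

Resolvents. The preconditioner is built so that `Φ + D` is block lower triangular (`lowerTri`).
Evaluating a resolvent means solving a triangular system whose first two blocks are local proximal
steps or projections. Hence the resolvent of `Φ⁻¹𝔸` exists and is unique even where `𝔸` is not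
monotone: each player needs convexity only in its own decision, the estimates of the others being
explicit.

Fixed points. Since the boxes contain the local sets, the zeros of `𝕋` are the points where `𝔸` and
`𝓑` have opposite values, and the resolvent of `Φ⁻¹𝔸` maps fixed points of `Rstar` to such zeros.
The last two rows of `𝕋` force consensus on a connected graph, and summing the first two rows over
the players gives the KKT system (`consensus_of_zero_mem_opT`). Conversely a v-SGNE has a
multiplier, by a Fritz John argument with the constraint qualification, and connectivity lets it be
completed to a zero of `𝕋`; so a fixed point exists.

Quasi-nonexpansiveness. A monotone operator has a nonexpansive reflected resolvent; this covers `𝓑`,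
and `𝔸` under the first alternative. Under the second one, `𝔸` is shown to be monotone only between
an arbitrary point and a consensual one (`ConvgLipschitz.monotoneAt_const`): splitting the estimates
into average and disagreement, the spectral gap of the Laplacian absorbs the cross terms. This
suffices, because the zeros produced by fixed points are consensual: `Rstar` does not increase the
distance to any fixed point (`formK_Rstar_sub_le`). Continuity of `Rstar` then has to be proved
separately.

Convergence. For a continuous quasi-nonexpansive operator in finite dimension, summable errors make
the iterates quasi-Fejér monotone, some subsequence of residuals tends to zero, and a cluster point
along it is a fixed point and the limit (`exists_tendsto_fixedPoint`). Summability of the errors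
themselves follows almost surely from that of their conditional expectations, by truncating at the
level sets of the predictable partial sums (`ae_tsum_lt_top_of_condLExp`). -/

theorem nonneg_of_forall_quadratic {K M : ℝ}
    (h : ∀ s : ℝ, 0 < s → s ≤ 1 → 0 ≤ s * K + s ^ 2 * M) : 0 ≤ K := by
  by_contra! hK
  have hM : 0 < |M| + 1 := by positivity
  obtain ⟨s, hs0, hs⟩ := exists_between (show 0 < min 1 (-K / (|M| + 1)) from
    lt_min one_pos (div_pos (by linarith) hM))
  have hs1 := hs.trans_le (min_le_left _ _)
  have hs2 := (lt_div_iff₀ hM).1 (hs.trans_le (min_le_right _ _))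
  have h1 := h s hs0 hs1.le
  have h2 : s * M ≤ s * |M| := mul_le_mul_of_nonneg_left (le_abs_self M) hs0.le
  have h3 : 0 ≤ s * (K + s * M) := by linarith [h1, show s * (K + s * M) = s * K + s ^ 2 * M by ring]
  have h4 := nonneg_of_mul_nonneg_right h3 hs0
  nlinarith

theorem linearMap_eq_dotProduct {κ : Type*} [Fintype κ] (l : (κ → ℝ) →ₗ[ℝ] ℝ) :
    ∃ g : κ → ℝ, ∀ x, l x = g ⬝ᵥ x := by
  classical
  refine ⟨fun i => l (Pi.single i 1), fun x => ?_⟩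
  rw [LinearMap.pi_apply_eq_sum_univ l x]
  refine Finset.sum_congr rfl fun i _ => ?_
  rw [smul_eq_mul, mul_comm]
  congr 2
  ext j
  simp [Pi.single_apply, eq_comm]

/-- Sum rule for the subdifferential of a convex function and a normal cone: a point minimizing
`f + a` over `C` has a subgradient `g` of `f` with `-(g + a)` normal to `C`. -/
theorem exists_subgradient_of_isMin {κ : Type*} [Fintype κ] {f : (κ → ℝ) → ℝ}
    (hf : ConvexOn ℝ Set.univ f) {C : Set (κ → ℝ)} (hC : Convex ℝ C) {v : κ → ℝ} (hv : v ∈ C)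
    (a : κ → ℝ) (h : ∀ x ∈ C, 0 ≤ f x - f v + a ⬝ᵥ (x - v)) :
    ∃ g : κ → ℝ, (∀ x, f v + g ⬝ᵥ (x - v) ≤ f x) ∧ ∀ x ∈ C, 0 ≤ (g + a) ⬝ᵥ (x - v) := by
  have hfc : Continuous f := hf.locallyLipschitz.continuous
  have hO : IsOpen {p : (κ → ℝ) × ℝ | f p.1 - f v < p.2} :=
    isOpen_lt (by fun_prop) (by fun_prop)
  have hOc : Convex ℝ {p : (κ → ℝ) × ℝ | f p.1 - f v < p.2} := by
    rintro ⟨x, r⟩ hx ⟨y, s⟩ hy α β hα hβ hαβ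
    simp only [Set.mem_ofPred_eq, Prod.smul_mk, Prod.mk_add_mk, smul_eq_mul] at hx hy ⊢
    have h1 := hf.2 (Set.mem_univ x) (Set.mem_univ y) hα hβ hαβ
    simp only [smul_eq_mul] at h1
    have h2 : f v = α * f v + β * f v := by rw [← add_mul, hαβ, one_mul]
    rcases hα.eq_or_lt with rfl | hα'
    · have : β = 1 := by linarith
      subst this
      simpa using hy
    · nlinarith [mul_lt_mul_of_pos_left hx hα', mul_le_mul_of_nonneg_left hy.le hβ]
  have hQc : Convex ℝ {p : (κ → ℝ) × ℝ | p.1 ∈ C ∧ p.2 ≤ -(a ⬝ᵥ (p.1 - v))} := by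
    rintro ⟨x, r⟩ hx ⟨y, s⟩ hy α β hα hβ hαβ
    simp only [Set.mem_ofPred_eq, Prod.smul_mk, Prod.mk_add_mk, smul_eq_mul] at hx hy ⊢
    refine ⟨hC hx.1 hy.1 hα hβ hαβ, ?_⟩
    have h2 : a ⬝ᵥ v = α * (a ⬝ᵥ v) + β * (a ⬝ᵥ v) := by rw [← add_mul, hαβ, one_mul]
    have h3 := mul_le_mul_of_nonneg_left hx.2 hα
    have h4 := mul_le_mul_of_nonneg_left hy.2 hβ
    simp only [dotProduct_sub, dotProduct_add, dotProduct_smul, smul_eq_mul] at h3 h4 ⊢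
    linarith
  -- Separate the strict epigraph of `f - f v` from the region over `C` below the graph of `-(a ⬝ᵥ
  -- (x - v))`; minimality of `v` makes them disjoint.
  obtain ⟨F, u, hF1, hF2⟩ := geometric_hahn_banach_open hOc hO hQc (by
    rw [Set.disjoint_left]
    rintro ⟨x, r⟩ hx ⟨hy, hr⟩
    have := h x hy
    simp only [Set.mem_ofPred_eq] at hx hr
    linarith)
  obtain ⟨g, hg⟩ := linearMap_eq_dotProduct (F.toLinearMap ∘ₗ LinearMap.inl ℝ (κ → ℝ) ℝ)
  have hF : ∀ x r, F (x, r) = g ⬝ᵥ x + r * F (0, 1) := by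
    intro x r
    have : ((x, r) : (κ → ℝ) × ℝ) = (x, 0) + r • (0, 1) := by simp
    rw [this, map_add, map_smul, ← hg]
    simp
  set β := F (0, 1)
  have hvQ : u ≤ g ⬝ᵥ v := by
    have := hF2 (v, 0) ⟨hv, by simp⟩
    rwa [hF, zero_mul, add_zero] at this
  -- The hyperplane is not vertical, because `(v, 1)` and `(v, 0)` lie on opposite sides. Dividing
  -- by `-β` turns its normal into the subgradient.
  have hβ : β < 0 := by
    have := hF1 (v, 1) (by simp)
    rw [hF] at this
    linarith
  have hO' : ∀ x, g ⬝ᵥ x + (f x - f v) * β ≤ u := by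
    intro x
    refine le_of_forall_pos_lt_add fun ε hε => ?_
    have := hF1 (x, f x - f v + ε / (-β)) (by simpa using div_pos hε (by linarith))
    rw [hF, add_mul, div_mul_eq_mul_div, mul_div_assoc] at this
    have hb : β / -β = -1 := by rw [div_neg, div_self hβ.ne]
    rw [hb] at this
    linarith
  have huv : g ⬝ᵥ v ≤ u := by simpa using hO' v
  have hβ' : 0 < (-β)⁻¹ := inv_pos.2 (by linarith)
  refine ⟨(-β)⁻¹ • g, fun x => ?_, fun x hx => ?_⟩
  · have h1 := hO' x
    have h2 : (-β)⁻¹ * (g ⬝ᵥ x - g ⬝ᵥ v) ≤ (-β)⁻¹ * ((f x - f v) * (-β)) :=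
      mul_le_mul_of_nonneg_left (by linarith) hβ'.le
    have h3 : (-β)⁻¹ * ((f x - f v) * (-β)) = f x - f v := by
      have := hβ.ne
      field_simp
    rw [smul_dotProduct, dotProduct_sub, smul_eq_mul]
    linarith
  · have h1 := hF2 (x, -(a ⬝ᵥ (x - v))) ⟨hx, le_rfl⟩
    rw [hF] at h1
    have h2 : 0 ≤ (-β)⁻¹ * (g ⬝ᵥ x - g ⬝ᵥ v + (a ⬝ᵥ (x - v)) * (-β)) :=
      mul_nonneg hβ'.le (by linarith)
    have h3 : (-β)⁻¹ * ((a ⬝ᵥ (x - v)) * (-β)) = a ⬝ᵥ (x - v) := by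
      have := hβ.ne
      field_simp
    rw [add_dotProduct, smul_dotProduct, smul_eq_mul, dotProduct_sub g]
    rw [mul_add, h3] at h2
    exact h2

theorem exists_subgradient {κ : Type*} [Fintype κ] {f : (κ → ℝ) → ℝ}
    (hf : ConvexOn ℝ Set.univ f) (v : κ → ℝ) : ∃ g : κ → ℝ, ∀ x, f v + g ⬝ᵥ (x - v) ≤ f x := by
  obtain ⟨g, hg, -⟩ := exists_subgradient_of_isMin hf (convex_singleton v) rfl 0 (by simp)
  exact ⟨g, hg⟩

/-- Existence for the proximal step of a convex function over a compact convex set. -/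
theorem exists_prox {κ : Type*} [Fintype κ] {f : (κ → ℝ) → ℝ}
    (hf : ConvexOn ℝ Set.univ f) {C : Set (κ → ℝ)} (hC : Convex ℝ C) (hCc : IsCompact C)
    (hne : C.Nonempty) (t : ℝ) (q : κ → ℝ) :
    ∃ v, ∃ g : κ → ℝ, (∀ x, f v + g ⬝ᵥ (x - v) ≤ f x) ∧
      ∃ w ∈ normalCone dotProduct C v, t • v + g + w = q := by
  have hfc : Continuous f := hf.locallyLipschitz.continuous
  have hcont : Continuous fun x : κ → ℝ => f x + (t / 2 * (x ⬝ᵥ x) - q ⬝ᵥ x) := by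
    unfold dotProduct
    fun_prop
  obtain ⟨v, hv, hmin⟩ := hCc.exists_isMinOn hne hcont.continuousOn
  obtain ⟨g, hg, hgC⟩ := exists_subgradient_of_isMin hf hC hv (t • v - q) (by
    intro x hx
    -- Compare `v` with `(1 - s) • v + s • x`: convexity bounds the increment of `f` by a multiple
    -- of `s`, and the only remainder of the quadratic term is of order `s ^ 2`, whatever the sign
    -- of `t`.
    refine nonneg_of_forall_quadratic (M := t / 2 * ((x - v) ⬝ᵥ (x - v))) fun s hs0 hs1 => ?_
    have hmem : (1 - s) • v + s • x ∈ C := hC hv hx (by linarith) hs0.le (by ring)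
    have h1 := hmin hmem
    have h2 := hf.2 (Set.mem_univ v) (Set.mem_univ x) (by linarith : 0 ≤ 1 - s) hs0.le (by ring)
    simp only [Set.mem_ofPred_eq, smul_eq_mul] at h1 h2
    simp only [dotProduct_add, add_dotProduct, dotProduct_smul, smul_dotProduct, smul_eq_mul,
      dotProduct_sub, sub_dotProduct, dotProduct_comm x v] at h1 ⊢
    linarith)
  refine ⟨v, g, hg, -(g + (t • v - q)), ⟨hv, fun z hz => ?_⟩, by abel⟩
  rw [neg_dotProduct]
  linarith [hgC z hz]

/-- A bilinear form that is symmetric and positive definite on a finite-dimensional space is the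
inner product of a Euclidean space, up to a linear isomorphism. -/
theorem exists_linearEquiv_euclideanSpace {V : Type*} [AddCommGroup V] [Module ℝ V]
    [FiniteDimensional ℝ V] (b : V →ₗ[ℝ] V →ₗ[ℝ] ℝ) (hsymm : ∀ x y, b x y = b y x)
    (hpos : ∀ x, x ≠ 0 → 0 < b x x) :
    ∃ (n : ℕ) (e : V ≃ₗ[ℝ] EuclideanSpace ℝ (Fin n)), ∀ x y, inner ℝ (e x) (e y) = b x y := by
  let core : InnerProductSpace.Core ℝ V :=
    { inner := fun x y => b x y
      conj_inner_symm := fun x y => by simp [hsymm y x]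
      re_inner_nonneg := fun x => by
        rcases eq_or_ne x 0 with rfl | hx
        · simp
        · simpa using (hpos x hx).le
      add_left := fun x y z => by simp
      smul_left := fun x y r => by simp
      definite := fun x hx => by
        by_contra h
        exact (hpos x h).ne' hx }
  let i1 : NormedAddCommGroup V := core.toNormedAddCommGroup
  let i2 : InnerProductSpace ℝ V := InnerProductSpace.ofCore core.toCore
  exact ⟨_, (stdOrthonormalBasis ℝ V).repr.toLinearEquiv,
    fun x y => (stdOrthonormalBasis ℝ V).repr.inner_map_map x y⟩

/-! ### Inexact Krasnosel'skii–Mann iterations -/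

/-- Convergence of the inexact Krasnosel'skii–Mann iteration of a continuous operator that is
quasi-nonexpansive with respect to its fixed points. Boundedness of the iterates is a consequence of
the summability of the errors. -/
theorem exists_tendsto_fixedPoint {E : Type*} [NormedAddCommGroup E] [InnerProductSpace ℝ E]
    [ProperSpace E] {T : E → E} (hT : Continuous T)
    (hq : ∀ p, T p = p → ∀ x, ‖T x - p‖ ≤ ‖x - p‖) (hfix : ∃ p, T p = p)
    {γ : ℕ → ℝ} (hγ : ∀ k, γ k ∈ Set.Icc (0 : ℝ) 1)
    (hγsum : Tendsto (fun M => ∑ k ∈ Finset.range M, γ k * (1 - γ k)) atTop atTop)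
    {x : ℕ → E} {e : ℕ → ℝ} (he : Summable e)
    (hx : ∀ k, ‖x (k + 1) - (x k + γ k • (T (x k) - x k))‖ ≤ e k) :
    ∃ p, T p = p ∧ Tendsto x atTop (𝓝 p) := by
  have he0 : ∀ k, 0 ≤ e k := fun k => (norm_nonneg _).trans (hx k)
  have hsq : ∀ p, T p = p → ∀ k, ‖x k + γ k • (T (x k) - x k) - p‖ ^ 2 ≤
      ‖x k - p‖ ^ 2 - γ k * (1 - γ k) * ‖T (x k) - x k‖ ^ 2 := by
    intro p hp k
    have h1 : ‖x k + γ k • (T (x k) - x k) - p‖ ^ 2 =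
        (1 - γ k) * ‖x k - p‖ ^ 2 + γ k * ‖T (x k) - p‖ ^ 2
          - γ k * (1 - γ k) * ‖T (x k) - x k‖ ^ 2 := by
      have e1 : x k + γ k • (T (x k) - x k) - p = (x k - p) + γ k • (T (x k) - x k) := by abel
      have e2 : T (x k) - p = (x k - p) + (T (x k) - x k) := by abel
      rw [e1, e2, norm_add_sq_real, norm_add_sq_real, norm_smul, inner_smul_right, mul_pow,
        Real.norm_eq_abs, sq_abs]
      ring
    have h2 : ‖T (x k) - p‖ ^ 2 ≤ ‖x k - p‖ ^ 2 := by
      have := hq p hp (x k)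
      gcongr
    nlinarith [mul_le_mul_of_nonneg_left h2 (hγ k).1]
  have hnn : ∀ k, 0 ≤ γ k * (1 - γ k) := fun k =>
    mul_nonneg (hγ k).1 (sub_nonneg.2 (hγ k).2)
  have hu : ∀ p, T p = p → ∀ k, ‖x k + γ k • (T (x k) - x k) - p‖ ≤ ‖x k - p‖ := by
    intro p hp k
    have h1 := hsq p hp k
    have h2 : 0 ≤ γ k * (1 - γ k) * ‖T (x k) - x k‖ ^ 2 := mul_nonneg (hnn k) (by positivity)
    exact (sq_le_sq₀ (norm_nonneg _) (norm_nonneg _)).1 (by linarith)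
  have hstep : ∀ p, T p = p → ∀ k, ‖x (k + 1) - p‖ ≤ ‖x k - p‖ + e k := by
    intro p hp k
    have h1 : x (k + 1) - p = (x (k + 1) - (x k + γ k • (T (x k) - x k))) +
      (x k + γ k • (T (x k) - x k) - p) := by abel
    rw [h1]
    linarith [norm_add_le (x (k + 1) - (x k + γ k • (T (x k) - x k)))
      (x k + γ k • (T (x k) - x k) - p), hu p hp k, hx k]
  -- from index `k` on, the distance to a fixed point grows at most by the remaining errors
  have htail : ∀ p, T p = p → ∀ k n, ‖x (k + n) - p‖ ≤ ‖x k - p‖ + ∑' j, e (j + k) := by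
    intro p hp k n
    have h1 : ‖x (k + n) - p‖ ≤ ‖x k - p‖ + ∑ j ∈ Finset.range n, e (j + k) := by
      induction n with
      | zero => simp
      | succ n ih =>
        rw [Finset.sum_range_succ, ← add_assoc k n 1]
        have := hstep p hp (k + n)
        rw [add_comm k n] at this ih ⊢
        linarith
    have h2 : ∑ j ∈ Finset.range n, e (j + k) ≤ ∑' j, e (j + k) :=
      ((summable_nat_add_iff k).2 he).sum_le_tsum _ fun _ _ => he0 _
    linarith
  obtain ⟨p₀, hp₀⟩ := hfix
  set M := ‖x 0 - p₀‖ + ∑' j, e (j + 0) with hM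
  have hbd : ∀ k, ‖x k - p₀‖ ≤ M := fun k => by
    have := htail p₀ hp₀ 0 k
    rwa [zero_add] at this
  have hM0 : 0 ≤ M := (norm_nonneg _).trans (hbd 0)
  set S := ∑' j, e j with hS
  have heS : ∀ k, e k ≤ S := fun k => he.le_tsum k fun _ _ => he0 _
  have hS0 : 0 ≤ S := (he0 0).trans (heS 0)
  -- Squaring the perturbed step costs `2 * M * e n + e n ^ 2`, which is at most `(2 * M + S) * e
  -- n`; then the squared distances telescope.
  have hsum : ∀ n, ∑ k ∈ Finset.range n, γ k * (1 - γ k) * ‖T (x k) - x k‖ ^ 2 ≤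
      M ^ 2 + (2 * M + S) * S := by
    intro n
    have h1 : ∀ n, ‖x n - p₀‖ ^ 2 + ∑ k ∈ Finset.range n, γ k * (1 - γ k) * ‖T (x k) - x k‖ ^ 2 ≤
        ‖x 0 - p₀‖ ^ 2 + (2 * M + S) * ∑ k ∈ Finset.range n, e k := by
      intro n
      induction n with
      | zero => simp
      | succ n ih =>
        rw [Finset.sum_range_succ, Finset.sum_range_succ, mul_add]
        have h2 : ‖x (n + 1) - p₀‖ ^ 2 ≤ (‖x n + γ n • (T (x n) - x n) - p₀‖ + e n) ^ 2 := by
          have h1 : x (n + 1) - p₀ = (x (n + 1) - (x n + γ n • (T (x n) - x n))) +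
            (x n + γ n • (T (x n) - x n) - p₀) := by abel
          have : ‖x (n + 1) - p₀‖ ≤ ‖x n + γ n • (T (x n) - x n) - p₀‖ + e n := by
            rw [h1]
            linarith [norm_add_le (x (n + 1) - (x n + γ n • (T (x n) - x n)))
              (x n + γ n • (T (x n) - x n) - p₀), hx n]
          gcongr
        have h3 := hsq p₀ hp₀ n
        have h4 := (hu p₀ hp₀ n).trans (hbd n)
        have h5 := mul_le_mul_of_nonneg_right h4 (he0 n)
        have h6 := mul_le_mul_of_nonneg_right (heS n) (he0 n)
        nlinarith
    have h2 := h1 n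
    have h3 : ∑ k ∈ Finset.range n, e k ≤ S := he.sum_le_tsum _ fun _ _ => he0 _
    have h4 : (2 * M + S) * ∑ k ∈ Finset.range n, e k ≤ (2 * M + S) * S :=
      mul_le_mul_of_nonneg_left h3 (by positivity)
    have h5 : ‖x 0 - p₀‖ ^ 2 ≤ M ^ 2 := by
      have := hbd 0
      gcongr
    have h6 : 0 ≤ ‖x n - p₀‖ ^ 2 := by positivity
    linarith
  -- Residuals eventually at least `δ` would bound the divergent sum of `γ k * (1 - γ k)`. As `T` is
  -- only quasi-nonexpansive, the residuals need not decrease, so smallness is obtained along a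
  -- subsequence only.
  have hfreq : ∀ δ > 0, ∃ᶠ k in atTop, ‖T (x k) - x k‖ < δ := by
    intro δ hδ hcon
    simp only [not_lt] at hcon
    obtain ⟨n₀, hn₀⟩ := eventually_atTop.1 hcon
    have h1 : ∀ n, δ ^ 2 * (∑ k ∈ Finset.range n, γ k * (1 - γ k)
        - ∑ k ∈ Finset.range n₀, γ k * (1 - γ k)) ≤ M ^ 2 + (2 * M + S) * S := by
      intro n
      rcases le_total n n₀ with hn | hn
      · have := Finset.sum_le_sum_of_subset_of_nonneg (Finset.range_mono hn)
          (f := fun k => γ k * (1 - γ k)) fun k _ _ => hnn k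
        have h2 : 0 ≤ M ^ 2 + (2 * M + S) * S := by positivity
        nlinarith [sq_nonneg δ]
      · refine le_trans ?_ (hsum n)
        rw [← Finset.sum_sdiff (Finset.range_mono hn), add_sub_cancel_right, Finset.mul_sum]
        refine le_trans (Finset.sum_le_sum fun k hk => ?_)
          (Finset.sum_le_sum_of_subset_of_nonneg Finset.sdiff_subset fun k _ _ =>
            mul_nonneg (hnn k) (sq_nonneg _))
        simp only [Finset.mem_sdiff, Finset.mem_range, not_lt] at hk
        rw [mul_comm]
        have := hn₀ k hk.2
        exact mul_le_mul_of_nonneg_left (by gcongr) (hnn k)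
    obtain ⟨n, hn⟩ := (hγsum.eventually_gt_atTop ((M ^ 2 + (2 * M + S) * S) / δ ^ 2
      + ∑ k ∈ Finset.range n₀, γ k * (1 - γ k))).exists
    have h2 := h1 n
    have hδ2 : 0 < δ ^ 2 := by positivity
    have h3 : (M ^ 2 + (2 * M + S) * S) / δ ^ 2 < ∑ k ∈ Finset.range n, γ k * (1 - γ k)
        - ∑ k ∈ Finset.range n₀, γ k * (1 - γ k) := by linarith
    rw [div_lt_iff₀ hδ2] at h3
    linarith
  obtain ⟨φ, hφ, hφlim⟩ := extraction_forall_of_frequently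
    (P := fun n k => ‖T (x k) - x k‖ < 1 / ((n : ℝ) + 1)) fun n => hfreq _ (by positivity)
  obtain ⟨p, -, θ, hθ, hlim⟩ := (isCompact_closedBall p₀ M).tendsto_subseq
    (x := fun n => x (φ n)) fun n => mem_closedBall_iff_norm.2 (hbd _)
  have hres : Tendsto (fun n => T (x (φ (θ n))) - x (φ (θ n))) atTop (𝓝 (T p - p)) :=
    ((hT.tendsto p).comp hlim).sub hlim
  have hres0 : Tendsto (fun n => T (x (φ (θ n))) - x (φ (θ n))) atTop (𝓝 0) :=
    squeeze_zero_norm (fun n => (hφlim (θ n)).le)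
      (tendsto_one_div_add_atTop_nhds_zero_nat.comp hθ.tendsto_atTop)
  have hp : T p = p := sub_eq_zero.1 (tendsto_nhds_unique hres hres0)
  refine ⟨p, hp, Metric.tendsto_atTop.2 fun ε hε => ?_⟩
  have hsub : Tendsto (fun n => φ (θ n)) atTop atTop :=
    hφ.tendsto_atTop.comp hθ.tendsto_atTop
  -- By `htail`, one late index close to `p` with a small error tail controls all later iterates.
  have ht : Tendsto (fun n => ‖x (φ (θ n)) - p‖ + ∑' j, e (j + φ (θ n))) atTop (𝓝 (0 + 0)) :=
    (tendsto_iff_norm_sub_tendsto_zero.1 hlim).add ((tendsto_sum_nat_add e).comp hsub)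
  rw [add_zero] at ht
  obtain ⟨n, hn⟩ := (ht.eventually_lt_const hε).exists
  refine ⟨φ (θ n), fun k hk => ?_⟩
  obtain ⟨l, rfl⟩ := Nat.exists_eq_add_of_le hk
  rw [dist_eq_norm]
  exact (htail p hp _ l).trans_lt hn

/-! ### Summability from conditional expectations -/

/-- The partial sums increase, so the retained terms form an initial segment whose sum is itself one
of the partial sums not exceeding `a`. -/
theorem sum_indicator_partialSum_le (w : ℕ → ℝ≥0∞) (a : ℝ≥0∞) :
    ∑' k, (if ∑ j ∈ Finset.range (k + 1), w j ≤ a then w k else 0) ≤ a := by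
  rw [ENNReal.tsum_eq_iSup_nat]
  refine iSup_le fun n => ?_
  induction n with
  | zero => simp
  | succ n ih =>
    by_cases h : ∑ j ∈ Finset.range (n + 1), w j ≤ a
    · refine le_trans (Finset.sum_le_sum fun k _ => ?_) h
      split_ifs <;> simp
    · rw [Finset.sum_range_succ, if_neg h, add_zero]
      exact ih

/-- If the weighted conditional expectations of nonnegative random variables along an increasing
sequence of sigma-algebras have an almost surely finite sum, then so do the variables. -/
theorem ae_tsum_lt_top_of_condLExp {Ω : Type*} {m₀ : MeasurableSpace Ω} (μ : Measure Ω)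
    [IsFiniteMeasure μ] (F : ℕ → MeasurableSpace Ω) (hF : Monotone F) (hle : ∀ k, F k ≤ m₀)
    (c : ℕ → ℝ≥0∞) (X : ℕ → Ω → ℝ≥0∞) (hX : ∀ k, Measurable (X k))
    (h : ∀ᵐ ω ∂μ, ∑' k, c k * condLExp (F k) μ (X k) ω < ∞) :
    ∀ᵐ ω ∂μ, ∑' k, c k * X k ω < ∞ := by
  let w : ℕ → Ω → ℝ≥0∞ := fun k ω => c k * condLExp (F k) μ (X k) ω
  have hw : ∀ k, Measurable[F k] (w k) := fun k => (measurable_condLExp _ _ _).const_mul _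
  -- The term `w k` is already measurable with respect to `F k`, so the partial sum may include
  -- index `k`, and the conditional expectation can be replaced by `X k` on this set.
  let A : ℕ → ℕ → Set Ω := fun a k => {ω | ∑ j ∈ Finset.range (k + 1), w j ω ≤ a}
  have hA : ∀ a k, MeasurableSet[F k] (A a k) := fun a k => by
    have : Measurable[F k] fun ω => ∑ j ∈ Finset.range (k + 1), w j ω :=
      Finset.measurable_fun_sum _ fun j hj =>
        (hw j).mono (hF (Nat.lt_succ_iff.1 (Finset.mem_range.1 hj))) le_rfl
    exact this measurableSet_Iic
  have hint : ∀ a : ℕ, ∫⁻ ω, ∑' k, (A a k).indicator (fun ω => c k * X k ω) ω ∂μ ≤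
      a * μ Set.univ := by
    intro a
    have hmeas : ∀ k, Measurable ((A a k).indicator fun ω => c k * X k ω) := fun k =>
      ((hX k).const_mul _).indicator (hle k _ (hA a k))
    have hmeas' : ∀ k, Measurable ((A a k).indicator fun ω => w k ω) := fun k =>
      ((hw k).mono (hle k) le_rfl).indicator (hle k _ (hA a k))
    calc ∫⁻ ω, ∑' k, (A a k).indicator (fun ω => c k * X k ω) ω ∂μ
        = ∫⁻ ω, ∑' k, (A a k).indicator (fun ω => w k ω) ω ∂μ := by
          rw [lintegral_tsum fun k => (hmeas k).aemeasurable,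
            lintegral_tsum fun k => (hmeas' k).aemeasurable]
          refine tsum_congr fun k => ?_
          rw [lintegral_indicator (hle k _ (hA a k)), lintegral_indicator (hle k _ (hA a k)),
            lintegral_const_mul _ (hX k),
            lintegral_const_mul _ (measurable_condLExp' _ _ _),
            setLIntegral_condLExp (hle k) μ (X k) (hA a k)]
      _ ≤ ∫⁻ _, a ∂μ := by
          refine lintegral_mono fun ω => ?_
          refine le_of_eq_of_le ?_ (sum_indicator_partialSum_le (fun k => w k ω) a)
          refine tsum_congr fun k => ?_
          simp only [A, Set.indicator_apply, Set.mem_ofPred_eq]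
      _ = a * μ Set.univ := lintegral_const _
  have hfin : ∀ᵐ ω ∂μ, ∀ a : ℕ, ∑' k, (A a k).indicator (fun ω => c k * X k ω) ω < ∞ := by
    refine ae_all_iff.2 fun a => ae_lt_top ?_ ((hint a).trans_lt ?_).ne
    · exact Measurable.tsum fun k => ((hX k).const_mul _).indicator (hle k _ (hA a k))
    · exact ENNReal.mul_lt_top (ENNReal.natCast_lt_top a) (measure_lt_top _ _)
  filter_upwards [h, hfin] with ω h1 h2
  -- Once `a` exceeds the full sum at `ω`, no term is truncated there.
  obtain ⟨a, ha⟩ := ENNReal.exists_nat_gt h1.ne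
  refine lt_of_eq_of_lt (tsum_congr fun k => ?_) (h2 a)
  rw [Set.indicator_of_mem]
  exact (ENNReal.sum_le_tsum _).trans ha.le

/-! ### The inner products -/

theorem dotProduct_self_nonneg_real {κ : Type*} [Fintype κ] (x : κ → ℝ) : 0 ≤ x ⬝ᵥ x :=
  Finset.sum_nonneg fun _ _ => mul_self_nonneg _

section BlockInner

variable {ι : Type*} [Fintype ι] {κ : ι → Type*} [∀ i, Fintype (κ i)]

theorem blockInner_comm (x y : ∀ i, κ i → ℝ) : blockInner x y = blockInner y x :=
  Finset.sum_congr rfl fun _ _ => dotProduct_comm _ _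

theorem blockInner_add_right (x y z : ∀ i, κ i → ℝ) :
    blockInner x (y + z) = blockInner x y + blockInner x z := by
  simp [blockInner, dotProduct_add, Finset.sum_add_distrib]

theorem blockInner_smul_right (a : ℝ) (x y : ∀ i, κ i → ℝ) :
    blockInner x (a • y) = a * blockInner x y := by
  simp [blockInner, Finset.mul_sum]

theorem blockInner_neg_right (x y : ∀ i, κ i → ℝ) : blockInner x (-y) = -blockInner x y := by
  simp [blockInner]

theorem blockInner_sub_right (x y z : ∀ i, κ i → ℝ) :
    blockInner x (y - z) = blockInner x y - blockInner x z := by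
  simp [blockInner, dotProduct_sub, Finset.sum_sub_distrib]

theorem blockInner_zero_right (x : ∀ i, κ i → ℝ) : blockInner x 0 = 0 := by
  simp [blockInner]

theorem blockInner_sum_smul_right {η : Type*} (s : Finset η) (x : ∀ i, κ i → ℝ) (a : η → ℝ)
    (v : η → ∀ i, κ i → ℝ) :
    blockInner x (∑ k ∈ s, a k • v k) = ∑ k ∈ s, a k * blockInner x (v k) := by
  classical
  induction s using Finset.induction_on with
  | empty => simp [blockInner_zero_right]
  | insert k s hk ih =>
    rw [Finset.sum_insert hk, Finset.sum_insert hk, blockInner_add_right, blockInner_smul_right, ih]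

theorem blockInner_add_left (x y z : ∀ i, κ i → ℝ) :
    blockInner (x + y) z = blockInner x z + blockInner y z := by
  simp [blockInner, add_dotProduct, Finset.sum_add_distrib]

theorem blockInner_sub_left (x y z : ∀ i, κ i → ℝ) :
    blockInner (x - y) z = blockInner x z - blockInner y z := by
  simp [blockInner, sub_dotProduct, Finset.sum_sub_distrib]

theorem blockInner_self_nonneg (x : ∀ i, κ i → ℝ) : 0 ≤ blockInner x x :=
  Finset.sum_nonneg fun _ _ => dotProduct_self_nonneg_real _

theorem blockInner_self_eq_zero {x : ∀ i, κ i → ℝ} : blockInner x x = 0 ↔ x = 0 := by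
  rw [blockInner, Finset.sum_eq_zero_iff_of_nonneg fun _ _ => dotProduct_self_nonneg_real _]
  simp [funext_iff]

end BlockInner

section StackInner

variable {ι : Type*} [Fintype ι] {κ : Type*} [Fintype κ] {σ : κ → Type*} [∀ j, Fintype (σ j)]

theorem stackInner_comm (x y : ι → ∀ j, σ j → ℝ) : stackInner x y = stackInner y x :=
  Finset.sum_congr rfl fun _ _ => blockInner_comm _ _

theorem stackInner_add_right (x y z : ι → ∀ j, σ j → ℝ) :
    stackInner x (y + z) = stackInner x y + stackInner x z := by
  simp [stackInner, blockInner_add_right, Finset.sum_add_distrib]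

theorem stackInner_smul_right (a : ℝ) (x y : ι → ∀ j, σ j → ℝ) :
    stackInner x (a • y) = a * stackInner x y := by
  simp [stackInner, blockInner_smul_right, Finset.mul_sum]

theorem stackInner_neg_right (x y : ι → ∀ j, σ j → ℝ) :
    stackInner x (-y) = -stackInner x y := by
  simp [stackInner, blockInner_neg_right]

theorem stackInner_sub_right (x y z : ι → ∀ j, σ j → ℝ) :
    stackInner x (y - z) = stackInner x y - stackInner x z := by
  simp [stackInner, blockInner_sub_right, Finset.sum_sub_distrib]

theorem stackInner_zero_right (x : ι → ∀ j, σ j → ℝ) : stackInner x 0 = 0 := by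
  simp [stackInner, blockInner_zero_right]

theorem stackInner_add_left (x y z : ι → ∀ j, σ j → ℝ) :
    stackInner (x + y) z = stackInner x z + stackInner y z := by
  rw [stackInner_comm, stackInner_add_right, stackInner_comm z, stackInner_comm z]

theorem stackInner_self_nonneg (x : ι → ∀ j, σ j → ℝ) : 0 ≤ stackInner x x :=
  Finset.sum_nonneg fun _ _ => blockInner_self_nonneg _

theorem stackInner_kron {η : Type*} [Fintype η] (M : Matrix ι η ℝ) (x : ι → ∀ j, σ j → ℝ)
    (y : η → ∀ j, σ j → ℝ) : stackInner x (kron M y) = stackInner (kron Mᵀ x) y := by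
  simp only [stackInner, kron, blockInner_sum_smul_right, Matrix.transpose_apply]
  simp only [blockInner_comm _ (y _), blockInner_sum_smul_right]
  exact Finset.sum_comm

end StackInner

theorem blockInner_kron {ι η κ : Type*} [Fintype ι] [Fintype η] [Fintype κ] (M : Matrix ι η ℝ)
    (x : ι → κ → ℝ) (y : η → κ → ℝ) :
    blockInner x (kron M y) = blockInner (kron Mᵀ x) y := by
  simp only [blockInner, kron, dotProduct_sum, sum_dotProduct, dotProduct_smul, smul_dotProduct,
    Matrix.transpose_apply]
  exact Finset.sum_comm

section Kron

variable {ι κ : Type*} [Fintype κ] {V : Type*} [AddCommGroup V] [Module ℝ V]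

theorem kron_add (M : Matrix ι κ ℝ) (v w : κ → V) : kron M (v + w) = kron M v + kron M w := by
  ext i
  simp [kron, Finset.sum_add_distrib]

theorem kron_smul (M : Matrix ι κ ℝ) (a : ℝ) (v : κ → V) : kron M (a • v) = a • kron M v := by
  ext i
  simp [kron, Finset.smul_sum, smul_comm a]

theorem kron_mul {η : Type*} [Fintype η] (M : Matrix ι κ ℝ) (M' : Matrix κ η ℝ) (v : η → V) :
    kron (M * M') v = kron M (kron M' v) := by
  ext i
  simp only [kron, Matrix.mul_apply, Finset.smul_sum, Finset.sum_smul, smul_smul]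
  exact Finset.sum_comm

end Kron

variable {N m : ℕ} {G : Game.{u} N m}

namespace Game

theorem laplacian_transpose : G.laplacianᵀ = G.laplacian := by
  simp [laplacian]

theorem selT_add (v w : G.Profile) : G.selT (v + w) = G.selT v + G.selT w := by
  ext1 i
  simp [selT, Pi.single_add]

theorem selT_smul (a : ℝ) (v : G.Profile) : G.selT (a • v) = a • G.selT v := by
  ext1 i
  simp [selT, Pi.single_smul]

theorem selT_sub (v w : G.Profile) : G.selT (v - w) = G.selT v - G.selT w := by
  ext1 i
  simp [selT, Pi.single_sub]

theorem selT_apply_self (v : G.Profile) (i : Fin N) : G.selT v i i = v i := by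
  simp [selT]

theorem selT_apply_of_ne (v : G.Profile) {i j : Fin N} (h : j ≠ i) : G.selT v i j = 0 := by
  simp [selT, h]

theorem stackInner_selT (y : G.Stack) (v : G.Profile) :
    stackInner y (G.selT v) = blockInner (fun i => y i i) v := by
  refine Finset.sum_congr rfl fun i _ => ?_
  rw [blockInner, Finset.sum_eq_single i]
  · rw [selT_apply_self]
  · intro j _ hj
    rw [selT_apply_of_ne _ hj, dotProduct_zero]
  · simp

theorem stackInner_ΛRT (y : G.Stack) (l : Fin N → Fin m → ℝ) :
    stackInner y (G.ΛRT l) = blockInner (G.ΛR y) l := by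
  rw [ΛRT, stackInner_selT]
  refine Finset.sum_congr rfl fun i _ => ?_
  simp only [ΛR]
  rw [Matrix.mulVec_transpose, dotProduct_comm, ← Matrix.dotProduct_mulVec, dotProduct_comm]

theorem ΛR_add (x y : G.Stack) : G.ΛR (x + y) = G.ΛR x + G.ΛR y := by
  ext1 i
  simp [ΛR, Matrix.mulVec_add]

theorem ΛR_smul (a : ℝ) (y : G.Stack) : G.ΛR (a • y) = a • G.ΛR y := by
  ext1 i
  simp [ΛR, Matrix.mulVec_smul]

theorem ΛRT_add (x y : Fin N → Fin m → ℝ) : G.ΛRT (x + y) = G.ΛRT x + G.ΛRT y := by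
  rw [ΛRT, ΛRT, ΛRT, ← selT_add]
  congr 1
  ext1 i
  simp [Matrix.mulVec_add]

theorem ΛRT_smul (a : ℝ) (x : Fin N → Fin m → ℝ) : G.ΛRT (a • x) = a • G.ΛRT x := by
  rw [ΛRT, ΛRT, ← selT_smul]
  congr 1
  ext1 i
  simp [Matrix.mulVec_smul]

theorem ptInner_comm (x y : G.Pt) : G.ptInner x y = G.ptInner y x := by
  simp only [ptInner, stackInner_comm x.1, blockInner_comm x.2.1, stackInner_comm x.2.2.1,
    blockInner_comm x.2.2.2]

theorem ptInner_add_right (x y z : G.Pt) :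
    G.ptInner x (y + z) = G.ptInner x y + G.ptInner x z := by
  simp only [ptInner, Prod.fst_add, Prod.snd_add, stackInner_add_right, blockInner_add_right]
  ring

theorem ptInner_smul_right (a : ℝ) (x y : G.Pt) :
    G.ptInner x (a • y) = a * G.ptInner x y := by
  simp only [ptInner, Prod.smul_fst, Prod.smul_snd, stackInner_smul_right, blockInner_smul_right]
  ring

end Game

/-! ### Linearity and symmetry of the operators `D` and `Φ`. -/

namespace Params

variable (p : Params G)

theorem opD_add (x y : G.Pt) : p.opD (x + y) = p.opD x + p.opD y := by
  simp only [opD, Prod.fst_add, Prod.snd_add, kron_add, Game.ΛRT_add, Game.ΛR_add, Prod.mk_add_mk,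
    smul_add]
  refine Prod.ext ?_ (Prod.ext ?_ (Prod.ext ?_ ?_)) <;> simp only <;> abel

theorem opD_smul (a : ℝ) (x : G.Pt) : p.opD (a • x) = a • p.opD x := by
  simp only [opD, Prod.smul_fst, Prod.smul_snd, kron_smul, Game.ΛRT_smul, Game.ΛR_smul,
    Prod.smul_mk, smul_add, smul_comm a, smul_neg, neg_smul]

theorem opD_sub (x y : G.Pt) : p.opD (x - y) = p.opD x - p.opD y := by
  rw [sub_eq_add_neg, opD_add, ← neg_one_smul ℝ y, opD_smul, neg_one_smul, ← sub_eq_add_neg]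

/-- The block lower triangular operator `Φ + D`. -/
noncomputable def lowerTri (x : G.Pt) : G.Pt :=
  (fun i => (p.τ₁ i)⁻¹ • x.1 i, (fun i => (p.τ₂ i)⁻¹ • x.2.1 i) - G.ΛR x.1,
    (fun e => (p.τ₃ e)⁻¹ • x.2.2.1 e) - kron G.incidenceᵀ x.1,
    (fun e => (p.τ₄ e)⁻¹ • x.2.2.2 e) - kron G.incidenceᵀ x.2.1)

/-- The halved couplings cancel above the diagonal and add up below it, and the Laplacian terms
cancel. This is what the choice of `Φ` is made for: resolvents are computed by forward substitution.
-/
theorem Φ_add_opD (x : G.Pt) : p.Φ x + p.opD x = p.lowerTri x := by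
  simp only [Φ, opD, lowerTri, Prod.mk_add_mk]
  refine Prod.ext ?_ (Prod.ext ?_ (Prod.ext ?_ ?_)) <;> simp only <;> module

theorem Φ_eq (x : G.Pt) : p.Φ x = p.lowerTri x - p.opD x :=
  eq_sub_of_add_eq (p.Φ_add_opD x)

theorem lowerTri_add (x y : G.Pt) : p.lowerTri (x + y) = p.lowerTri x + p.lowerTri y := by
  simp only [lowerTri, Prod.fst_add, Prod.snd_add, kron_add, Game.ΛR_add, Pi.add_apply, smul_add]
  refine Prod.ext ?_ (Prod.ext ?_ (Prod.ext ?_ ?_)) <;> ext1 i <;> simp <;> abel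

theorem lowerTri_smul (a : ℝ) (x : G.Pt) : p.lowerTri (a • x) = a • p.lowerTri x := by
  simp only [lowerTri, Prod.smul_fst, Prod.smul_snd, kron_smul, Game.ΛR_smul, Pi.smul_apply,
    smul_comm _ a]
  refine Prod.ext ?_ (Prod.ext ?_ (Prod.ext ?_ ?_)) <;> ext1 i <;> simp [smul_sub]

theorem Φ_add (x y : G.Pt) : p.Φ (x + y) = p.Φ x + p.Φ y := by
  rw [Φ_eq, Φ_eq, Φ_eq, opD_add, lowerTri_add]
  abel

theorem Φ_smul (a : ℝ) (x : G.Pt) : p.Φ (a • x) = a • p.Φ x := by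
  rw [Φ_eq, Φ_eq, opD_smul, lowerTri_smul, smul_sub]

theorem Φ_sub (x y : G.Pt) : p.Φ (x - y) = p.Φ x - p.Φ y := by
  rw [sub_eq_add_neg, Φ_add, ← neg_one_smul ℝ y, Φ_smul, neg_one_smul, ← sub_eq_add_neg]

/-- The inner product given by the design matrix, as a bilinear form. -/
noncomputable def formK : G.Pt →ₗ[ℝ] G.Pt →ₗ[ℝ] ℝ :=
  LinearMap.mk₂ ℝ (fun x y => G.ptInner x (p.Φ y))
    (fun x y z => by
      rw [Game.ptInner_comm, Game.ptInner_add_right, Game.ptInner_comm _ x, Game.ptInner_comm _ y])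
    (fun a x y => by
      rw [Game.ptInner_comm, Game.ptInner_smul_right, Game.ptInner_comm, smul_eq_mul])
    (fun x y z => by rw [Φ_add, Game.ptInner_add_right])
    (fun a x y => by rw [Φ_smul, Game.ptInner_smul_right, smul_eq_mul])

theorem formK_apply (x y : G.Pt) : p.formK x y = G.ptInner x (p.Φ y) := rfl

theorem formK_comm (x y : G.Pt) : p.formK x y = p.formK y x := by
  simp only [formK_apply, Game.ptInner, Φ, stackInner_add_right, stackInner_sub_right,
    blockInner_add_right, blockInner_sub_right, stackInner_smul_right, blockInner_smul_right,
    Game.stackInner_ΛRT]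
  rw [stackInner_kron, Game.laplacian_transpose, stackInner_kron _ x.1 y.2.2.1,
    stackInner_kron _ y.1 x.2.2.1, blockInner_kron _ x.2.1 y.2.1, Game.laplacian_transpose,
    blockInner_kron _ x.2.1 y.2.2.2, blockInner_kron _ y.2.1 x.2.2.2,
    stackInner_comm (kron G.laplacian x.1), blockInner_comm (kron G.laplacian x.2.1),
    stackInner_comm (kron G.incidenceᵀ x.1), stackInner_comm (kron G.incidenceᵀ y.1),
    blockInner_comm (kron G.incidenceᵀ x.2.1), blockInner_comm (kron G.incidenceᵀ y.2.1),
    blockInner_comm (G.ΛR x.1), blockInner_comm (G.ΛR y.1)]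
  have e1 : stackInner x.1 (fun i => (p.τ₁ i)⁻¹ • y.1 i)
      = stackInner y.1 (fun i => (p.τ₁ i)⁻¹ • x.1 i) := by
    simp [stackInner, blockInner_smul_right, blockInner_comm]
  have e2 : blockInner x.2.1 (fun i => (p.τ₂ i)⁻¹ • y.2.1 i)
      = blockInner y.2.1 (fun i => (p.τ₂ i)⁻¹ • x.2.1 i) := by
    simp [blockInner, dotProduct_comm]
  have e3 : stackInner x.2.2.1 (fun i => (p.τ₃ i)⁻¹ • y.2.2.1 i)
      = stackInner y.2.2.1 (fun i => (p.τ₃ i)⁻¹ • x.2.2.1 i) := by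
    simp [stackInner, blockInner_smul_right, blockInner_comm]
  have e4 : blockInner x.2.2.2 (fun i => (p.τ₄ i)⁻¹ • y.2.2.2 i)
      = blockInner y.2.2.2 (fun i => (p.τ₄ i)⁻¹ • x.2.2.2 i) := by
    simp [blockInner, dotProduct_comm]
  rw [e1, e2, e3, e4]
  ring

/-- The couplings in `D` form a skew-symmetric part, so only the consensus terms survive in the
quadratic form. -/
theorem ptInner_opD_self (x : G.Pt) : G.ptInner x (p.opD x) =
    p.ρμ / 2 * stackInner x.1 (kron G.laplacian x.1)
      + p.ρz / 2 * blockInner x.2.1 (kron G.laplacian x.2.1) := by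
  simp only [Game.ptInner, opD, stackInner_add_right,
    blockInner_add_right, stackInner_smul_right, blockInner_smul_right,
    Game.stackInner_ΛRT]
  rw [stackInner_kron G.incidence, blockInner_kron G.incidence,
    stackInner_comm (kron G.incidenceᵀ x.1), blockInner_comm (kron G.incidenceᵀ x.2.1),
    blockInner_comm (G.ΛR x.1)]
  ring

end Params

/-! ### The communication network -/

theorem kron_single {ι κ : Type*} [Fintype κ] [DecidableEq κ] {V : Type*} [AddCommGroup V]
    [Module ℝ V] (M : Matrix ι κ ℝ) (k : κ) (v : V) (i : ι) :
    kron M (Pi.single k v) i = M i k • v := by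
  rw [kron, Finset.sum_eq_single k]
  · simp
  · intro j _ hj
    simp [hj]
  · simp

namespace Game

section Network

variable {V : Type*} [AddCommGroup V] [Module ℝ V]

theorem kron_incidence_transpose_apply (v : Fin N → V) (e : G.Edge) :
    kron G.incidenceᵀ v e = v e.1.2 - v e.1.1 := by
  simp [kron, incidence, sub_smul, Finset.sum_sub_distrib, ite_smul]

theorem sum_kron_incidence (z : G.Edge → V) : ∑ i, kron G.incidence z i = 0 := by
  simp only [kron]
  rw [Finset.sum_comm]
  refine Finset.sum_eq_zero fun e _ => ?_
  rw [← Finset.sum_smul]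
  simp [incidence]

theorem sum_kron_laplacian (v : Fin N → V) : ∑ i, kron G.laplacian v i = 0 := by
  rw [laplacian, kron_mul, sum_kron_incidence]

theorem kron_incidence_transpose_const (x : V) : kron G.incidenceᵀ (fun _ => x) = 0 := by
  ext1 e
  simp [kron_incidence_transpose_apply]

theorem kron_laplacian_const (x : V) : kron G.laplacian (fun _ => x) = 0 := by
  rw [laplacian, kron_mul, kron_incidence_transpose_const]
  ext1 i
  simp [kron]

theorem _root_.SGNEP.Communicable.eq_of_kron_incidence_transpose (h : Communicable G)
    {v : Fin N → V} (hv : kron G.incidenceᵀ v = 0) (i j : Fin N) : v i = v j := by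
  obtain h' := (SimpleGraph.reachable_iff_reflTransGen i j).1 (h.connected.preconnected i j)
  induction h' with
  | refl => rfl
  | @tail a b _ hab ih =>
    rw [ih]
    have hE : ∀ a b : Fin N, (a, b) ∈ G.edges → v a = v b := fun a b he => by
      have := congrFun hv ⟨(a, b), he⟩
      rw [kron_incidence_transpose_apply] at this
      exact (sub_eq_zero.1 this).symm
    rcases hab.2 with he | he
    · exact hE _ _ he
    · exact (hE _ _ he).symm

/-- A unit flow along a path from `j` to `i` has divergence concentrated at its two ends, and such
differences span all stacks of sum zero. -/
theorem _root_.SGNEP.Communicable.exists_kron_incidence (h : Communicable G)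
    {s : Fin N → V} (hs : ∑ i, s i = 0) : ∃ z : G.Edge → V, kron G.incidence z = s := by
  let K : (G.Edge → V) →ₗ[ℝ] (Fin N → V) :=
    { toFun := kron G.incidence, map_add' := kron_add _, map_smul' := kron_smul _ }
  suffices hK : s ∈ LinearMap.range K from hK
  have hpair : ∀ i j (v : V), Pi.single i v - Pi.single j v ∈ LinearMap.range K := by
    intro i j v
    obtain h' := (SimpleGraph.reachable_iff_reflTransGen i j).1 (h.connected.preconnected i j)
    induction h' with
    | refl => simp
    | @tail a b _ hab ih =>
      have hE : ∀ a b : Fin N, (a, b) ∈ G.edges →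
          (Pi.single b v - Pi.single a v : Fin N → V) ∈ LinearMap.range K := fun a b he => by
        refine ⟨Pi.single ⟨(a, b), he⟩ v, ?_⟩
        ext1 i
        change kron _ _ i = _
        rw [kron_single]
        simp only [incidence, sub_smul, ite_smul, one_smul, zero_smul, Pi.sub_apply,
          Pi.single_apply, eq_comm]
      have hab' : (Pi.single a v - Pi.single b v : Fin N → V) ∈ LinearMap.range K := by
        rcases hab.2 with he | he
        · rw [← neg_sub]
          exact neg_mem (hE _ _ he)
        · exact hE _ _ he
      have := add_mem ih hab'
      rwa [sub_add_sub_cancel] at this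
  obtain ⟨i₀⟩ := h.connected.nonempty
  -- The blocks subtracted at the reference node `i₀` add up to zero, because `s` does.
  have : s = ∑ i, (Pi.single i (s i) - Pi.single i₀ (s i)) := by
    rw [Finset.sum_sub_distrib, Finset.univ_sum_single]
    have h0 : ∑ i, Pi.single (M := fun _ : Fin N => V) i₀ (s i) = 0 := by
      have := map_sum (AddMonoidHom.single (fun _ : Fin N => V) i₀) s Finset.univ
      simp only [AddMonoidHom.single_apply, hs, Pi.single_zero] at this
      exact this.symm
    rw [h0, sub_zero]
  rw [this]
  exact sum_mem fun i _ => hpair i i₀ (s i)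

end Network

/-! ### Spectral gap of the Laplacian. -/

theorem dotProduct_laplacian_mulVec (x y : Fin N → ℝ) :
    x ⬝ᵥ (G.laplacian *ᵥ y) = (G.incidenceᵀ *ᵥ x) ⬝ᵥ (G.incidenceᵀ *ᵥ y) := by
  rw [laplacian, ← Matrix.mulVec_mulVec, Matrix.dotProduct_mulVec, Matrix.mulVec_transpose _ x]

theorem kron_eq_mulVec {ι κ : Type*} [Fintype κ] (M : Matrix ι κ ℝ) (x : κ → ℝ) :
    kron M x = M *ᵥ x := by
  ext i
  simp [kron, Matrix.mulVec, dotProduct]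

/-- Spectral gap of the Laplacian: `s` may be any lower bound of its positive eigenvalues. -/
theorem _root_.SGNEP.Communicable.le_dotProduct_laplacian (h : Communicable G) {s : ℝ}
    (hs : ∀ t : ℝ, 0 < t → Module.End.HasEigenvalue (Matrix.toLin' G.laplacian) t → s ≤ t)
    {x : Fin N → ℝ} (hx : ∑ i, x i = 0) : s * (x ⬝ᵥ x) ≤ x ⬝ᵥ (G.laplacian *ᵥ x) := by
  have hL : G.laplacian.IsHermitian := by
    rw [Matrix.IsHermitian, Matrix.conjTranspose_eq_transpose_of_trivial, laplacian_transpose]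
  let b := hL.eigenvectorBasis
  have hb : ∀ k, G.laplacian *ᵥ (b k).ofLp = hL.eigenvalues k • (b k).ofLp :=
    hL.mulVec_eigenvectorBasis
  have hin : ∀ u v : Fin N → ℝ, inner ℝ (WithLp.toLp 2 u) (WithLp.toLp 2 v) = u ⬝ᵥ v := by
    intro u v
    rw [EuclideanSpace.inner_eq_star_dotProduct]
    simp [dotProduct_comm]
  have hb1 : ∀ k, (b k).ofLp ⬝ᵥ (b k).ofLp = 1 := by
    intro k
    rw [← hin]
    exact (real_inner_self_eq_norm_sq _).trans (by simp [b.norm_eq_one])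
  have hexp : ∀ u v : Fin N → ℝ, u ⬝ᵥ v = ∑ k, ((b k).ofLp ⬝ᵥ u) * ((b k).ofLp ⬝ᵥ v) := by
    intro u v
    rw [← hin, ← b.sum_inner_mul_inner]
    refine Finset.sum_congr rfl fun k _ => ?_
    rw [real_inner_comm]
    congr 1
    · exact hin _ _
    · exact hin _ _
  rw [hexp x x, hexp x (G.laplacian *ᵥ x), Finset.mul_sum]
  refine Finset.sum_le_sum fun k _ => ?_
  have h1 : (b k).ofLp ⬝ᵥ (G.laplacian *ᵥ x) = hL.eigenvalues k * ((b k).ofLp ⬝ᵥ x) := by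
    rw [dotProduct_laplacian_mulVec, dotProduct_comm, ← dotProduct_laplacian_mulVec, hb,
      dotProduct_smul, smul_eq_mul, dotProduct_comm x]
  have h2 : hL.eigenvalues k
      = (G.incidenceᵀ *ᵥ (b k).ofLp) ⬝ᵥ (G.incidenceᵀ *ᵥ (b k).ofLp) := by
    rw [← dotProduct_laplacian_mulVec, hb, dotProduct_smul, hb1, smul_eq_mul, mul_one]
  rw [h1]
  have h3 : 0 ≤ hL.eigenvalues k := by
    rw [h2]
    exact dotProduct_self_nonneg_real _
  rcases h3.eq_or_lt with h4 | h4
  -- An eigenvector of eigenvalue zero is killed by the transposed incidence matrix, hence constant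
  -- by connectivity and orthogonal to `x`.
  · rw [← h4] at h2
    have h5 := dotProduct_self_eq_zero.1 h2.symm
    rw [← kron_eq_mulVec] at h5
    obtain ⟨i₀⟩ := h.connected.nonempty
    have h6 : (b k).ofLp ⬝ᵥ x = 0 := by
      rw [dotProduct, Finset.sum_congr rfl fun i _ => by
        rw [h.eq_of_kron_incidence_transpose h5 i i₀], ← Finset.mul_sum, hx, mul_zero]
    simp [h6]
  · have h5 : Module.End.HasEigenvalue (Matrix.toLin' G.laplacian) (hL.eigenvalues k) := by
      refine Module.End.hasEigenvalue_of_hasEigenvector (x := (b k).ofLp) ⟨?_, fun h0 => ?_⟩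
      · rw [Module.End.mem_eigenspace_iff, Matrix.toLin'_apply]
        exact hb k
      · have := hb1 k
        rw [h0] at this
        simp at this
    have h6 := hs _ h4 h5
    nlinarith [mul_le_mul_of_nonneg_right h6 (mul_self_nonneg ((b k).ofLp ⬝ᵥ x))]

theorem stackInner_eq_sum_coord (x y : G.Stack) :
    stackInner x y = ∑ j, ∑ a, (fun i => x i j a) ⬝ᵥ (fun i => y i j a) := by
  simp only [stackInner, blockInner, dotProduct]
  rw [Finset.sum_comm]
  exact Finset.sum_congr rfl fun _ _ => Finset.sum_comm

theorem _root_.SGNEP.Communicable.le_stackInner_laplacian (h : Communicable G) {s : ℝ}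
    (hs : ∀ t : ℝ, 0 < t → Module.End.HasEigenvalue (Matrix.toLin' G.laplacian) t → s ≤ t)
    {y : G.Stack} (hy : ∑ i, y i = 0) :
    s * stackInner y y ≤ stackInner y (kron G.laplacian y) := by
  rw [stackInner_eq_sum_coord, stackInner_eq_sum_coord, Finset.mul_sum]
  refine Finset.sum_le_sum fun j _ => ?_
  rw [Finset.mul_sum]
  refine Finset.sum_le_sum fun a _ => ?_
  have h1 : (fun i => kron G.laplacian y i j a) = G.laplacian *ᵥ fun i => y i j a := by
    ext i
    simp [kron, Matrix.mulVec, dotProduct]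
  rw [h1]
  refine h.le_dotProduct_laplacian hs ?_
  have := congrFun (congrFun hy j) a
  simpa using this

theorem stackInner_laplacian_nonneg (y : G.Stack) : 0 ≤ stackInner y (kron G.laplacian y) := by
  rw [laplacian, kron_mul, stackInner_kron]
  exact stackInner_self_nonneg _

theorem blockInner_laplacian_nonneg (y : Fin N → Fin m → ℝ) :
    0 ≤ blockInner y (kron G.laplacian y) := by
  rw [laplacian, kron_mul, blockInner_kron]
  exact blockInner_self_nonneg _

end Game

/-! ### Normal cones and partial subdifferentials -/

theorem normalCone_dotProduct_monotone {κ : Type*} [Fintype κ] {S : Set (κ → ℝ)}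
    {x x' w w' : κ → ℝ} (h : w ∈ normalCone dotProduct S x) (h' : w' ∈ normalCone dotProduct S x') :
    0 ≤ (x - x') ⬝ᵥ (w - w') := by
  have h1 := h.2 x' h'.1
  have h2 := h'.2 x h.1
  rw [dotProduct_sub, dotProduct_comm _ w, dotProduct_comm _ w']
  have h3 : w ⬝ᵥ (x - x') = -(w ⬝ᵥ (x' - x)) := by rw [← dotProduct_neg, neg_sub]
  linarith

theorem normalCone_blockInner_monotone {ι : Type*} [Fintype ι] {κ : ι → Type*}
    [∀ i, Fintype (κ i)] {S : Set (∀ i, κ i → ℝ)} {x x' w w' : ∀ i, κ i → ℝ}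
    (h : w ∈ normalCone blockInner S x) (h' : w' ∈ normalCone blockInner S x') :
    0 ≤ blockInner (x - x') (w - w') := by
  have h1 := h.2 x' h'.1
  have h2 := h'.2 x h.1
  rw [blockInner_sub_right, blockInner_comm _ w, blockInner_comm _ w']
  have h3 : blockInner w (x - x') = -(blockInner w (x' - x)) := by
    rw [← blockInner_neg_right, neg_sub]
  linarith

/-- The normal cone of an extended set acts on the own blocks only. -/
theorem mem_normalCone_extSet {S : ∀ i, Set (Fin (G.n i) → ℝ)} {y u : G.Stack} :
    u ∈ normalCone stackInner (G.extSet S) y ↔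
      ∃ w : G.Profile, u = G.selT w ∧ ∀ i, w i ∈ normalCone dotProduct (S i) (y i i) := by
  constructor
  · rintro ⟨hy, hu⟩
    have hpert : ∀ (i j : Fin N) (d : Fin (G.n j) → ℝ), (j = i → y i j + d ∈ S j) →
        u i j ⬝ᵥ d ≤ 0 := by
      intro i j d hd
      have h1 := hu (y + Pi.single i (Pi.single j d)) (by
        intro k
        by_cases hk : k = i
        · subst hk
          by_cases hj : j = k
          · subst hj
            simpa using hd rfl
          · have : (Pi.single j d : G.Profile) k = 0 := by simp [Ne.symm hj]
            simpa [this] using hy k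
        · have : (Pi.single i (Pi.single j d) : G.Stack) k = 0 := by simp [hk]
          simpa [this] using hy k)
      rw [add_sub_cancel_left] at h1
      refine le_of_eq_of_le ?_ h1
      rw [stackInner, Finset.sum_eq_single i, blockInner, Finset.sum_eq_single j]
      · simp
      · intro k _ hk
        simp [hk]
      · simp
      · intro k _ hk
        simp [hk, blockInner_zero_right]
      · simp
    refine ⟨fun i => u i i, ?_, fun i => ⟨hy i, fun z hz => hpert i i _ (by simpa using hz)⟩⟩
    ext1 i
    ext1 j
    by_cases hj : j = i
    · subst hj
      rw [Game.selT_apply_self]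
    · rw [Game.selT_apply_of_ne _ hj]
      -- The estimates of the others are unconstrained, so the block `u i j` is itself an admissible
      -- perturbation.
      exact dotProduct_self_eq_zero.1 (le_antisymm (hpert i j _ fun h => absurd h hj)
        (dotProduct_self_nonneg_real _))
  · rintro ⟨w, rfl, hw⟩
    refine ⟨fun i => (hw i).1, fun z hz => ?_⟩
    rw [stackInner_comm, Game.stackInner_selT]
    refine Finset.sum_nonpos fun i _ => ?_
    rw [dotProduct_comm]
    exact (hw i).2 _ (hz i)

theorem ScenarioObjectives.convexOn_expJ (h : ScenarioObjectives G) (i : Fin N) (x : G.Profile) :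
    ConvexOn ℝ Set.univ fun v => G.expJ i (Function.update x i v) := by
  refine ⟨convex_univ, fun v _ v' _ a b ha hb hab => ?_⟩
  have hi := fun v => h.integrable i (Function.update x i v)
  simp only [Game.expJ]
  rw [smul_eq_mul, smul_eq_mul, ← integral_const_mul, ← integral_const_mul,
    ← integral_add ((hi v).const_mul a) ((hi v').const_mul b)]
  exact integral_mono (hi _) (((hi v).const_mul a).add ((hi v').const_mul b)) fun ω =>
    (h.convex i ω x).2 trivial trivial ha hb hab

namespace Game

theorem mem_partialSubdiff_update {i : Fin N} {x : G.Profile} {v g : Fin (G.n i) → ℝ} :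
    g ∈ G.partialSubdiff i (Function.update x i v) ↔ ∀ v', G.expJ i (Function.update x i v)
      + g ⬝ᵥ (v' - v) ≤ G.expJ i (Function.update x i v') := by
  simp [partialSubdiff]

/-- As the other decisions agree, both subgradients belong to the same convex function of the own
decision. -/
theorem partialSubdiff_monotone {i : Fin N} {x x' : G.Profile} (hxx : ∀ j, j ≠ i → x j = x' j)
    {g g' : Fin (G.n i) → ℝ} (hg : g ∈ G.partialSubdiff i x) (hg' : g' ∈ G.partialSubdiff i x') :
    0 ≤ (x i - x' i) ⬝ᵥ (g - g') := by
  have e1 : Function.update x i (x' i) = x' := by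
    ext1 j
    by_cases hj : j = i
    · subst hj; simp
    · simp [hj, hxx j hj]
  have e2 : Function.update x' i (x i) = x := by rw [← e1]; simp
  have h1 := hg (x' i)
  have h2 := hg' (x i)
  rw [e1] at h1
  rw [e2] at h2
  have h3 : g ⬝ᵥ (x' i - x i) = -(g ⬝ᵥ (x i - x' i)) := by rw [← dotProduct_neg, neg_sub]
  rw [dotProduct_sub, dotProduct_comm _ g, dotProduct_comm _ g']
  linarith

theorem _root_.SGNEP.ScenarioObjectives.partialSubdiff_nonempty (h : ScenarioObjectives G)
    (i : Fin N) (x : G.Profile) : (G.partialSubdiff i x).Nonempty := by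
  obtain ⟨g, hg⟩ := exists_subgradient (h.convexOn_expJ i x) (x i)
  exact ⟨g, fun v => by simpa using hg v⟩

theorem _root_.SGNEP.ScenarioObjectives.extPseudograd_nonempty (h : ScenarioObjectives G)
    (y : G.Stack) : (G.extPseudograd y).Nonempty := by
  choose g hg using fun i => h.partialSubdiff_nonempty i (y i)
  exact ⟨g, hg⟩

theorem mem_normalCone_nonnegDual {l v : Fin N → Fin m → ℝ} (h : v ∈ normalCone blockInner
    (nonnegDual N m) l) (i : Fin N) : v i ∈ normalCone dotProduct {l | ∀ a, 0 ≤ l a} (l i) := by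
  refine ⟨h.1 i, fun z hz => ?_⟩
  have h1 := h.2 (Function.update l i z) (by
    intro k
    by_cases hk : k = i
    · subst hk
      simpa using hz
    · simpa [hk] using h.1 k)
  refine le_of_eq_of_le ?_ h1
  rw [blockInner, Finset.sum_eq_single i]
  · simp
  · intro k _ hk
    simp [hk]
  · simp

theorem mem_normalCone_nonneg {κ : Type*} [Fintype κ] {l v : κ → ℝ} :
    v ∈ normalCone dotProduct {l | ∀ a, 0 ≤ l a} l ↔
      (∀ a, 0 ≤ l a) ∧ (∀ a, v a ≤ 0) ∧ v ⬝ᵥ l = 0 := by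
  classical
  constructor
  · rintro ⟨hl, hv⟩
    have h1 : ∀ a, v a ≤ 0 := fun a => by
      have := hv (l + Pi.single a 1) (fun b => add_nonneg (hl b) (by
        by_cases hb : b = a
        · subst hb; simp
        · simp [hb]))
      simpa using this
    refine ⟨hl, h1, le_antisymm ?_ ?_⟩
    · exact Finset.sum_nonpos fun a _ => mul_nonpos_of_nonpos_of_nonneg (h1 a) (hl a)
    · have := hv 0 (fun _ => le_rfl)
      simpa using this
  · rintro ⟨hl, hv, hvl⟩
    refine ⟨hl, fun z hz => ?_⟩
    rw [dotProduct_sub, hvl, sub_zero]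
    exact Finset.sum_nonpos fun a _ => mul_nonpos_of_nonpos_of_nonneg (hv a) (hz a)

end Game

/-! ### The resolvents of the preconditioned operators -/

namespace Params

variable {p : Params G}

theorem resolvent_mem {V : Type*} [AddCommGroup V] {T : V → Set V}
    (h : ∀ q, ∃! r, r ∈ resolventSet T q) (q : V) : resolvent T q ∈ resolventSet T q :=
  Classical.epsilon_spec (h q).exists

theorem mem_resolventSet_iff {T : G.Pt → Set G.Pt} {q r : G.Pt} :
    r ∈ resolventSet (fun ψ => p.Φ ⁻¹' T ψ) q ↔ p.Φ q - p.Φ r ∈ T r := by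
  rw [← Φ_sub]
  rfl

theorem mem_resolventSet_pA {q r : G.Pt} : r ∈ resolventSet p.pA q ↔
    ∃ g ∈ G.extPseudograd r.1, ∃ w : G.Profile,
      (∀ i, w i ∈ normalCone dotProduct (Set.Icc (p.lo i) (p.hi i)) (r.1 i i)) ∧
      p.Φ q = p.lowerTri r + (G.selT (g + w), p.cLoc, 0, 0) := by
  refine mem_resolventSet_iff.trans ⟨?_, ?_⟩
  · rintro ⟨g, hg, u, hu, h⟩
    obtain ⟨w, rfl, hw⟩ := mem_normalCone_extSet.1 hu
    refine ⟨g, hg, w, hw, ?_⟩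
    rw [← Φ_add_opD, Game.selT_add, add_assoc, ← h]
    abel
  · rintro ⟨g, hg, w, hw, h⟩
    refine ⟨g, hg, _, mem_normalCone_extSet.2 ⟨w, rfl, hw⟩, ?_⟩
    rw [h, ← Φ_add_opD, Game.selT_add]
    abel

theorem mem_resolventSet_pB {q r : G.Pt} : r ∈ resolventSet p.pB q ↔
    ∃ w : G.Profile, (∀ i, w i ∈ normalCone dotProduct (G.X i) (r.1 i i)) ∧
    ∃ v ∈ normalCone blockInner (Game.nonnegDual N m) r.2.1,
      p.Φ q = p.lowerTri r + (G.selT w, v, 0, 0) := by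
  refine mem_resolventSet_iff.trans ⟨?_, ?_⟩
  · rintro ⟨u, hu, v, hv, h⟩
    obtain ⟨w, rfl, hw⟩ := mem_normalCone_extSet.1 hu
    refine ⟨w, hw, v, hv, ?_⟩
    rw [← Φ_add_opD, add_assoc, ← h]
    abel
  · rintro ⟨w, hw, v, hv, h⟩
    refine ⟨_, mem_normalCone_extSet.2 ⟨w, rfl, hw⟩, v, hv, ?_⟩
    rw [h, ← Φ_add_opD]
    abel

/-- The lower triangular system is solved by forward substitution, once its first two blocks are. -/
theorem exists_lowerTri (hp : p.Admissible) (Q b : G.Pt) (hb3 : b.2.2.1 = 0) (hb4 : b.2.2.2 = 0)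
    (y : G.Stack) (l : Fin N → Fin m → ℝ) (hy : (fun i => (p.τ₁ i)⁻¹ • y i) + b.1 = Q.1)
    (hl : (fun i => (p.τ₂ i)⁻¹ • l i) - G.ΛR y + b.2.1 = Q.2.1) :
    ∃ r : G.Pt, r.1 = y ∧ r.2.1 = l ∧ Q = p.lowerTri r + b := by
  refine ⟨(y, l, fun e => p.τ₃ e • (Q.2.2.1 e + kron G.incidenceᵀ y e),
    fun e => p.τ₄ e • (Q.2.2.2 e + kron G.incidenceᵀ l e)), rfl, rfl, ?_⟩
  refine Prod.ext ?_ (Prod.ext ?_ (Prod.ext ?_ ?_))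
  · exact hy.symm
  · exact hl.symm
  · ext1 e
    simp [lowerTri, hb3, smul_smul, inv_mul_cancel₀ (hp.τ₃_pos e).ne']
  · ext1 e
    simp [lowerTri, hb4, smul_smul, inv_mul_cancel₀ (hp.τ₄_pos e).ne']

theorem existsUnique_resolventSet_pA (hp : p.Admissible) (h1 : ScenarioObjectives G)
    (h2 : FeasibleSets G) (q : G.Pt) : ∃! r, r ∈ resolventSet p.pA q := by
  refine existsUnique_of_exists_of_unique ?_ ?_
  · let x : G.Stack := fun i => p.τ₁ i • (p.Φ q).1 i
    -- The blocks of `x i` other than the own one already solve their rows. The own row is a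
    -- proximal step over the box, which is compact and contains the nonempty `G.X i`.
    choose v g hg w hw hvgw using fun i => exists_prox (h1.convexOn_expJ i (x i))
      (convex_Icc (p.lo i) (p.hi i)) isCompact_Icc ((h2.nonempty i).mono (hp.subset_box i))
      (p.τ₁ i)⁻¹ ((p.Φ q).1 i i)
    obtain ⟨r, hr1, hr2, hr⟩ := exists_lowerTri hp (p.Φ q) (G.selT (g + w), p.cLoc, 0, 0) rfl rfl
      (fun i => Function.update (x i) i (v i))
      (fun i => p.τ₂ i • ((p.Φ q).2.1 i + G.A i *ᵥ v i - p.cLoc i))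
      (by
        ext1 i
        ext1 j
        by_cases hj : j = i
        · subst hj
          simp only [Pi.add_apply, Pi.smul_apply, Function.update_self, Game.selT_apply_self]
          rw [← hvgw j, add_assoc]
        · simp [hj, Game.selT_apply_of_ne _ hj, x, smul_smul,
            inv_mul_cancel₀ (hp.τ₁_pos i).ne'])
      (by
        ext1 i
        simp only [Pi.add_apply, Pi.sub_apply, Game.ΛR, smul_smul,
          inv_mul_cancel₀ (hp.τ₂_pos i).ne', one_smul, Function.update_self]
        abel)
    refine ⟨r, mem_resolventSet_pA.2 ⟨g, fun i => ?_, w, fun i => ?_, hr⟩⟩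
    · rw [hr1]
      exact Game.mem_partialSubdiff_update.2 (hg i)
    · rw [hr1]
      simpa using hw i
  · intro r r' hr hr'
    obtain ⟨g, hg, w, hw, h⟩ := mem_resolventSet_pA.1 hr
    obtain ⟨g', hg', w', hw', h'⟩ := mem_resolventSet_pA.1 hr'
    rw [h] at h'
    have e1 : ∀ i j, (p.τ₁ i)⁻¹ • r.1 i j + G.selT (g + w) i j
        = (p.τ₁ i)⁻¹ • r'.1 i j + G.selT (g' + w') i j := fun i j =>
      congrFun (congrFun (congrArg Prod.fst h') i) j
    have hne : ∀ i j, j ≠ i → r.1 i j = r'.1 i j := by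
      intro i j hj
      have := e1 i j
      rw [Game.selT_apply_of_ne _ hj, Game.selT_apply_of_ne _ hj, add_zero, add_zero] at this
      exact smul_right_injective _ (inv_pos.2 (hp.τ₁_pos i)).ne' this
    have hy : r.1 = r'.1 := by
      ext1 i
      ext1 j
      by_cases hj : j = i
      · subst hj
        have e2 := e1 j j
        simp only [Game.selT_apply_self, Pi.add_apply] at e2
        -- By `hne` the estimates of the others coincide, so monotonicity in the own decision
        -- applies and the term with `(p.τ₁ j)⁻¹` forces equality.
        have h3 := Game.partialSubdiff_monotone (hne j) (hg j) (hg' j)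
        have h4 := normalCone_dotProduct_monotone (hw j) (hw' j)
        have e3 : (p.τ₁ j)⁻¹ • (r.1 j j - r'.1 j j) = -((g j - g' j) + (w j - w' j)) := by
          rw [smul_sub, sub_eq_iff_eq_add, eq_sub_of_add_eq e2]
          abel
        have h5 : (p.τ₁ j)⁻¹ * ((r.1 j j - r'.1 j j) ⬝ᵥ (r.1 j j - r'.1 j j)) ≤ 0 := by
          rw [← smul_eq_mul, ← dotProduct_smul, e3, dotProduct_neg, dotProduct_add]
          linarith
        have h6 := nonpos_of_mul_nonpos_right h5 (inv_pos.2 (hp.τ₁_pos j))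
        exact sub_eq_zero.1 (dotProduct_self_eq_zero.1
          (le_antisymm h6 (dotProduct_self_nonneg_real _)))
      · exact hne i j hj
    have hl : r.2.1 = r'.2.1 := by
      ext1 i
      have := congrFun (congrArg (fun z : G.Pt => z.2.1) h') i
      simp only [lowerTri, Prod.mk_add_mk, Pi.add_apply, Pi.sub_apply, hy, add_left_inj,
        sub_left_inj] at this
      exact smul_right_injective _ (inv_pos.2 (hp.τ₂_pos i)).ne' this
    refine Prod.ext hy (Prod.ext hl (Prod.ext ?_ ?_))
    · ext1 i
      have := congrFun (congrArg (fun z : G.Pt => z.2.2.1) h') i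
      simp only [lowerTri, Prod.mk_add_mk, Pi.add_apply, Pi.sub_apply, hy, add_left_inj,
        sub_left_inj] at this
      exact smul_right_injective _ (inv_pos.2 (hp.τ₃_pos i)).ne' this
    · ext1 i
      have := congrFun (congrArg (fun z : G.Pt => z.2.2.2) h') i
      simp only [lowerTri, Prod.mk_add_mk, Pi.add_apply, Pi.sub_apply, hl, add_left_inj,
        sub_left_inj] at this
      exact smul_right_injective _ (inv_pos.2 (hp.τ₄_pos i)).ne' this

theorem exists_mem_resolventSet_pB (hp : p.Admissible) (h2 : FeasibleSets G) (q : G.Pt) :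
    ∃ r, r ∈ resolventSet p.pB q := by
  choose x g hg w hw hxgw using fun i => exists_prox (convexOn_const (0 : ℝ) convex_univ)
    (h2.convex i) (h2.compact i) (h2.nonempty i) (p.τ₁ i)⁻¹ ((p.Φ q).1 i i)
  -- The proximal step of the zero function is a projection; testing its subgradient in its own
  -- direction shows that it vanishes.
  have hg0 : ∀ i, g i = 0 := fun i => by
    have := hg i (x i + g i)
    rw [add_sub_cancel_left, zero_add] at this
    exact dotProduct_self_eq_zero.1 (le_antisymm this (dotProduct_self_nonneg_real _))
  let y : G.Stack := fun i => Function.update (p.τ₁ i • (p.Φ q).1 i) i (x i)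
  let s : Fin N → Fin m → ℝ := (p.Φ q).2.1 + G.ΛR y
  -- The multiplier block is a projection onto the orthant: `s` splits into its positive part,
  -- scaled by `τ₂` to give the multiplier, and its negative part, which is the normal vector.
  obtain ⟨r, hr1, hr2, hr⟩ := exists_lowerTri hp (p.Φ q)
    (G.selT w, fun i a => min 0 (s i a), 0, 0) rfl rfl y
    (fun i a => p.τ₂ i * max 0 (s i a))
    (by
      ext1 i
      ext1 j
      by_cases hj : j = i
      · subst hj
        simp only [y, Pi.add_apply, Pi.smul_apply, Function.update_self, Game.selT_apply_self]
        rw [← hxgw j, hg0, add_zero]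
      · simp [hj, Game.selT_apply_of_ne _ hj, y, smul_smul,
          inv_mul_cancel₀ (hp.τ₁_pos i).ne'])
    (by
      ext i a
      simp only [Pi.add_apply, Pi.sub_apply, Pi.smul_apply, smul_eq_mul]
      rw [inv_mul_cancel_left₀ (hp.τ₂_pos i).ne']
      have h1 := max_add_min 0 (s i a)
      have h2 : s i a = (p.Φ q).2.1 i a + G.ΛR y i a := rfl
      linarith)
  refine ⟨r, mem_resolventSet_pB.2 ⟨w, fun i => ?_, _, ⟨?_, fun z hz => ?_⟩, hr⟩⟩
  · rw [hr1]
    simpa [y] using hw i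
  · rw [hr2]
    exact fun i a => mul_nonneg (hp.τ₂_pos i).le (le_max_left _ _)
  · rw [hr2]
    refine Finset.sum_nonpos fun i _ => Finset.sum_nonpos fun a _ => ?_
    simp only [Pi.sub_apply]
    rcases le_total 0 (s i a) with h | h
    · simp [h]
    · rw [max_eq_left h, mul_zero, sub_zero]
      exact mul_nonpos_of_nonpos_of_nonneg (min_le_left _ _) (hz i a)

end Params

/-! ### Monotonicity -/

namespace Params

variable {p : Params G}

/-- Monotonicity of `𝓡ᵀ𝔽 + (ρμ/2) L_n` with respect to the point `y'`. -/
def MonotoneAt (p : Params G) (y' : G.Stack) : Prop :=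
  ∀ y, ∀ g ∈ G.extPseudograd y, ∀ g' ∈ G.extPseudograd y',
    0 ≤ stackInner (y - y') (G.selT (g - g') + (p.ρμ / 2) • kron G.laplacian (y - y'))

theorem _root_.SGNEP.ConvgMonotone.monotoneAt (h : ConvgMonotone p) (y' : G.Stack) :
    p.MonotoneAt y' := by
  intro y g hg g' hg'
  have h1 := h.1 y y' _ _ ⟨g, hg, rfl⟩ ⟨g', hg', rfl⟩
  have h2 : kron G.laplacian (y - y') = kron G.laplacian y - kron G.laplacian y' := by
    rw [sub_eq_add_neg, kron_add, ← neg_one_smul ℝ y', kron_smul, neg_one_smul, ← sub_eq_add_neg]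
  rw [Game.selT_sub, h2, smul_sub]
  refine h1.trans_eq ?_
  congr 1
  abel

theorem normalCone_stackInner_monotone {S : ∀ i, Set (Fin (G.n i) → ℝ)} {y y' u u' : G.Stack}
    (h : u ∈ normalCone stackInner (G.extSet S) y)
    (h' : u' ∈ normalCone stackInner (G.extSet S) y') :
    0 ≤ stackInner (y - y') (u - u') := by
  have h1 := h.2 y' h'.1
  have h2 := h'.2 y h.1
  rw [stackInner_sub_right, stackInner_comm _ u, stackInner_comm _ u']
  have h3 : stackInner u (y - y') = -(stackInner u (y' - y)) := by
    rw [← stackInner_neg_right, neg_sub]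
  linarith

theorem ptInner_mk_zero (z : G.Pt) (u : G.Stack) (v : Fin N → Fin m → ℝ) :
    G.ptInner z (u, v, 0, 0) = stackInner z.1 u + blockInner z.2.1 v := by
  simp only [Game.ptInner, stackInner_zero_right, blockInner_zero_right, add_zero]

theorem mk_sub_mk_zero (u u' : G.Stack) (v v' : Fin N → Fin m → ℝ) :
    ((u, v, 0, 0) : G.Pt) - (u', v', 0, 0) = (u - u', v - v', 0, 0) := by
  simp only [Prod.mk_sub_mk, sub_self]
  rfl

/-- The half of the consensus term that `D` gives to `𝔸` is exactly the one in `MonotoneAt`; the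
skew couplings drop out and all other contributions are nonnegative. -/
theorem opA_monotoneAt (hp : p.Admissible) {x x' w w' : G.Pt} (hx' : p.MonotoneAt x'.1)
    (hw : w ∈ p.opA x) (hw' : w' ∈ p.opA x') : 0 ≤ G.ptInner (x - x') (w - w') := by
  obtain ⟨g, hg, u, hu, rfl⟩ := hw
  obtain ⟨g', hg', u', hu', rfl⟩ := hw'
  have h1 := hx' x.1 g hg g' hg'
  have h2 := normalCone_stackInner_monotone hu hu'
  have h3 := G.blockInner_laplacian_nonneg (x.2.1 - x'.2.1)
  have h4 := mul_nonneg (div_nonneg hp.ρz_nonneg zero_le_two) h3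
  rw [stackInner_add_right, stackInner_smul_right] at h1
  rw [add_sub_add_comm, ← opD_sub, Game.ptInner_add_right, ptInner_opD_self]
  have h5 : G.ptInner (x - x') ((G.selT g + u, p.cLoc, 0, 0) - (G.selT g' + u', p.cLoc, 0, 0))
      = stackInner (x.1 - x'.1) (G.selT (g - g')) + stackInner (x.1 - x'.1) (u - u') := by
    rw [← stackInner_add_right, mk_sub_mk_zero, ptInner_mk_zero, sub_self,
      blockInner_zero_right, add_zero, Game.selT_sub, add_sub_add_comm, Prod.fst_sub]
  rw [h5]
  simp only [Prod.fst_sub, Prod.snd_sub] at *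
  linarith

theorem opB_monotone (hp : p.Admissible) {x x' w w' : G.Pt}
    (hw : w ∈ p.opB x) (hw' : w' ∈ p.opB x') : 0 ≤ G.ptInner (x - x') (w - w') := by
  obtain ⟨u, hu, v, hv, rfl⟩ := hw
  obtain ⟨u', hu', v', hv', rfl⟩ := hw'
  have h1 := mul_nonneg (div_nonneg hp.ρμ_nonneg zero_le_two) (G.stackInner_laplacian_nonneg (x.1 - x'.1))
  have h2 := normalCone_stackInner_monotone hu hu'
  have h3 := mul_nonneg (div_nonneg hp.ρz_nonneg zero_le_two)
    (G.blockInner_laplacian_nonneg (x.2.1 - x'.2.1))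
  have h4 := normalCone_blockInner_monotone hv hv'
  rw [add_sub_add_comm, ← opD_sub, Game.ptInner_add_right, ptInner_opD_self]
  have h5 : G.ptInner (x - x') ((u, v, 0, 0) - (u', v', 0, 0))
      = stackInner (x.1 - x'.1) (u - u') + blockInner (x.2.1 - x'.2.1) (v - v') := by
    rw [mk_sub_mk_zero, ptInner_mk_zero, Prod.fst_sub, Prod.snd_sub, Prod.fst_sub]
  rw [h5]
  simp only [Prod.fst_sub, Prod.snd_sub] at *
  linarith

/-! ### Reflected resolvents in the metric of the design matrix -/

/-- With `s = r - r'` and `d = (q - q') - s`, the claim is `|s - d|² ≤ |s + d|²` in the metric of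
`Φ`, that is, the hypothesis that `s` and `d` have nonnegative inner product. -/
theorem formK_self_reflection_le {q q' r r' : G.Pt}
    (h : 0 ≤ G.ptInner (r - r') ((p.Φ q - p.Φ r) - (p.Φ q' - p.Φ r'))) :
    p.formK (((2 : ℕ) • r - q) - ((2 : ℕ) • r' - q')) (((2 : ℕ) • r - q) - ((2 : ℕ) • r' - q'))
      ≤ p.formK (q - q') (q - q') := by
  have e1 : ((2 : ℕ) • r - q) - ((2 : ℕ) • r' - q') = (r - r') - ((q - q') - (r - r')) := by
    module
  have e2 : p.formK (q - q') (q - q')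
      = p.formK ((r - r') + ((q - q') - (r - r'))) ((r - r') + ((q - q') - (r - r'))) := by
    rw [add_sub_cancel]
  have e3 : (p.Φ q - p.Φ r) - (p.Φ q' - p.Φ r') = p.Φ ((q - q') - (r - r')) := by
    simp only [Φ_sub]
    abel
  rw [e3, ← formK_apply] at h
  rw [e1, e2]
  generalize (q - q') - (r - r') = d at *
  generalize r - r' = s at *
  simp only [map_sub, map_add, LinearMap.sub_apply, LinearMap.add_apply]
  rw [p.formK_comm d s]
  linarith

theorem reflectedResolvent_pA_le (hp : p.Admissible)
    (hA : ∀ q, ∃! r, r ∈ resolventSet p.pA q) (q q' : G.Pt)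
    (hq' : p.MonotoneAt (resolvent p.pA q').1) :
    p.formK (reflectedResolvent p.pA q - reflectedResolvent p.pA q')
      (reflectedResolvent p.pA q - reflectedResolvent p.pA q') ≤ p.formK (q - q') (q - q') :=
  formK_self_reflection_le (opA_monotoneAt hp hq' (mem_resolventSet_iff.1 (resolvent_mem hA q))
    (mem_resolventSet_iff.1 (resolvent_mem hA q')))

theorem existsUnique_resolventSet_pB (hp : p.Admissible) (h2 : FeasibleSets G)
    (h6 : DesignPosDef p) (q : G.Pt) : ∃! r, r ∈ resolventSet p.pB q := by
  refine existsUnique_of_exists_of_unique (exists_mem_resolventSet_pB hp h2 q)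
    fun r r' hr hr' => ?_
  have h := opB_monotone hp (mem_resolventSet_iff.1 hr) (mem_resolventSet_iff.1 hr')
  have e : p.Φ q - p.Φ r - (p.Φ q - p.Φ r') = (-1 : ℝ) • p.Φ (r - r') := by
    rw [Φ_sub]
    module
  rw [e, Game.ptInner_smul_right] at h
  by_contra hne
  have := h6 _ (sub_ne_zero.2 hne)
  linarith

theorem reflectedResolvent_pB_le (hp : p.Admissible)
    (hB : ∀ q, ∃! r, r ∈ resolventSet p.pB q) (q q' : G.Pt) :
    p.formK (reflectedResolvent p.pB q - reflectedResolvent p.pB q')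
      (reflectedResolvent p.pB q - reflectedResolvent p.pB q') ≤ p.formK (q - q') (q - q') :=
  formK_self_reflection_le (opB_monotone hp (mem_resolventSet_iff.1 (resolvent_mem hB q))
    (mem_resolventSet_iff.1 (resolvent_mem hB q')))

/-! ### Fixed points and zeros -/

theorem surjective_Φ (h6 : DesignPosDef p) : Function.Surjective p.Φ := by
  let f : G.Pt →ₗ[ℝ] G.Pt := { toFun := p.Φ, map_add' := p.Φ_add, map_smul' := p.Φ_smul }
  have hf : Function.Injective f := by
    refine (injective_iff_map_eq_zero f).2 fun x hx => ?_
    by_contra hne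
    have h := h6 x hne
    have hx' : p.Φ x = (0 : ℝ) • x := by rw [zero_smul]; exact hx
    rw [hx', Game.ptInner_smul_right, zero_mul] at h
    exact lt_irrefl _ h
  exact LinearMap.injective_iff_surjective.1 hf

/-- The two copies of `D` add up to the linear part of `𝕋`. The box cone adds nothing: zero belongs
to it at points of the local sets, and its elements there are normal to the smaller sets. -/
theorem zero_mem_opT_iff (hp : p.Admissible) {x : G.Pt} :
    0 ∈ p.opT x ↔ ∃ w ∈ p.opA x, -w ∈ p.opB x := by
  have hLL : ∀ a : ℝ, a • kron G.laplacian x.1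
      = (a / 2) • kron G.laplacian x.1 + (a / 2) • kron G.laplacian x.1 := fun a => by module
  have hLL' : ∀ a : ℝ, a • kron G.laplacian x.2.1
      = (a / 2) • kron G.laplacian x.2.1 + (a / 2) • kron G.laplacian x.2.1 := fun a => by module
  have hadd : ∀ (g : G.Profile) (u : G.Stack) (v : Fin N → Fin m → ℝ),
      ((G.selT g + G.ΛRT x.2.1 + kron G.incidence x.2.2.1 + p.ρμ • kron G.laplacian x.1 + u,
         v - G.ΛR x.1 + p.cLoc + kron G.incidence x.2.2.2 + p.ρz • kron G.laplacian x.2.1,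
         -kron G.incidenceᵀ x.1, -kron G.incidenceᵀ x.2.1) : G.Pt)
      = p.opD x + (G.selT g, p.cLoc, 0, 0) + (p.opD x + (u, v, 0, 0)) := by
    intro g u v
    simp only [opD, Prod.mk_add_mk]
    refine Prod.ext ?_ (Prod.ext ?_ (Prod.ext ?_ ?_)) <;> simp only <;> module
  have hsplit : ∀ (g : G.Profile) (u : G.Stack),
      ((G.selT g + u, p.cLoc, 0, 0) : G.Pt) = (G.selT g, p.cLoc, 0, 0) + (u, 0, 0, 0) := by
    intro g u
    simp
  constructor
  · rintro ⟨g, hg, u, hu, v, hv, h⟩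
    rw [hadd] at h
    refine ⟨p.opD x + (G.selT g, p.cLoc, 0, 0), ⟨g, hg, 0, ⟨fun i => hp.subset_box i (hu.1 i),
      fun z _ => ?_⟩, by rw [add_zero]⟩, u, hu, v, hv, (neg_eq_of_add_eq_zero_right h.symm)⟩
    rw [stackInner_comm, stackInner_zero_right]
  · rintro ⟨w, ⟨g, hg, u, hu, rfl⟩, u', hu', v, hv, h⟩
    refine ⟨g, hg, u + u', ⟨hu'.1, fun z hz => ?_⟩, v, hv, ?_⟩
    · rw [stackInner_add_left]
      exact add_nonpos (hu.2 z fun i => hp.subset_box i (hz i)) (hu'.2 z hz)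
    · rw [hadd]
      have e : ((u + u', v, 0, 0) : G.Pt) = (u, 0, 0, 0) + (u', v, 0, 0) := by simp
      rw [e, ← add_assoc (p.opD x), add_comm (p.opD x) (u, 0, 0, 0), add_assoc (u, 0, 0, 0), ← h,
        hsplit]
      abel

/-- With `r` the first resolvent value, `q` is fixed exactly when the second resolvent sends the
reflection `2r - q` back to `r`. -/
theorem Rstar_eq_self_iff (hA : ∀ q, ∃! r, r ∈ resolventSet p.pA q)
    (hB : ∀ q, ∃! r, r ∈ resolventSet p.pB q) {q : G.Pt} :
    p.Rstar q = q ↔ p.Φ q - p.Φ (resolvent p.pA q) ∈ p.opA (resolvent p.pA q) ∧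
      p.Φ (resolvent p.pA q) - p.Φ q ∈ p.opB (resolvent p.pA q) := by
  have hAq := mem_resolventSet_iff.1 (resolvent_mem hA q)
  have hBq := mem_resolventSet_iff.1 (resolvent_mem hB (reflectedResolvent p.pA q))
  set r := resolvent p.pA q with hr
  have hrefl : reflectedResolvent p.pA q = (2 : ℕ) • r - q := rfl
  have hΦ : p.Φ (reflectedResolvent p.pA q) - p.Φ r = p.Φ r - p.Φ q := by
    rw [← Φ_sub, ← Φ_sub, hrefl]
    congr 1
    module
  constructor
  · intro h
    refine ⟨hAq, ?_⟩
    have h1 : resolvent p.pB (reflectedResolvent p.pA q) = r := by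
      have h2 : (2 : ℕ) • resolvent p.pB (reflectedResolvent p.pA q)
          - ((2 : ℕ) • r - q) = q := h
      have h3 : (2 : ℝ) • (resolvent p.pB (reflectedResolvent p.pA q) - r) = 0 := by
        rw [smul_sub, ofNat_smul_eq_nsmul ℝ 2, ofNat_smul_eq_nsmul ℝ 2, sub_eq_zero]
        have := sub_eq_zero.2 h2
        rw [← sub_eq_zero, ← this]
        abel
      exact sub_eq_zero.1 ((smul_eq_zero.1 h3).resolve_left two_ne_zero)
    rw [h1, hΦ] at hBq
    exact hBq
  · rintro ⟨-, h⟩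
    rw [← hΦ] at h
    have h1 := (hB _).unique (resolvent_mem hB (reflectedResolvent p.pA q))
      (mem_resolventSet_iff.2 h)
    change (2 : ℕ) • resolvent p.pB (reflectedResolvent p.pA q) - reflectedResolvent p.pA q = q
    rw [h1, hrefl]
    abel

theorem zero_mem_opT_of_Rstar_eq_self (hp : p.Admissible)
    (hA : ∀ q, ∃! r, r ∈ resolventSet p.pA q) (hB : ∀ q, ∃! r, r ∈ resolventSet p.pB q) {q : G.Pt}
    (h : p.Rstar q = q) : 0 ∈ p.opT (resolvent p.pA q) := by
  obtain ⟨h1, h2⟩ := (Rstar_eq_self_iff hA hB).1 h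
  exact (zero_mem_opT_iff hp).2 ⟨_, h1, by rwa [neg_sub]⟩

/-- If `Φ d` lies in `𝔸 x` and `-Φ d` in `𝓑 x`, then `x + d` is fixed and its first resolvent value
is `x`. -/
theorem exists_Rstar_eq_self (hp : p.Admissible) (h6 : DesignPosDef p)
    (hA : ∀ q, ∃! r, r ∈ resolventSet p.pA q) (hB : ∀ q, ∃! r, r ∈ resolventSet p.pB q) {x : G.Pt}
    (hx : 0 ∈ p.opT x) : ∃ q, p.Rstar q = q := by
  obtain ⟨w, hwA, hwB⟩ := (zero_mem_opT_iff hp).1 hx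
  obtain ⟨d, rfl⟩ := surjective_Φ h6 w
  have h1 : p.Φ (x + d) - p.Φ x = p.Φ d := by rw [Φ_add, add_sub_cancel_left]
  have h2 : resolvent p.pA (x + d) = x :=
    (hA _).unique (resolvent_mem hA _) (mem_resolventSet_iff.2 (by rwa [h1]))
  refine ⟨x + d, (Rstar_eq_self_iff hA hB).2 ?_⟩
  rw [h2, ← neg_sub (p.Φ (x + d)) (p.Φ x), h1]
  exact ⟨hwA, hwB⟩

end Params

/-! ### Lipschitz pseudogradients -/

theorem abs_blockInner_le {ι : Type*} [Fintype ι] {κ : ι → Type*} [∀ i, Fintype (κ i)]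
    (x y : ∀ i, κ i → ℝ) : |blockInner x y| ≤ √(blockInner x x) * √(blockInner y y) := by
  rw [← Real.sqrt_mul (blockInner_self_nonneg _)]
  refine Real.abs_le_sqrt ?_
  rcases (blockInner_self_nonneg y).eq_or_lt with h | h
  · rw [blockInner_self_eq_zero.1 h.symm, blockInner_zero_right, blockInner_zero_right]
    simp
  -- Cauchy–Schwarz: this vector is a multiple of the component of `x` orthogonal to `y`.
  · have h1 := blockInner_self_nonneg (blockInner y y • x - blockInner x y • y)
    simp only [blockInner_sub_left, blockInner_sub_right, blockInner_smul_right] at h1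
    rw [blockInner_comm (_ • x) x, blockInner_comm (_ • x) y, blockInner_comm (_ • y) x,
      blockInner_comm (_ • y) y] at h1
    simp only [blockInner_smul_right, blockInner_comm y x] at h1
    have h2 : 0 ≤ blockInner y y * (blockInner x x * blockInner y y - blockInner x y ^ 2) := by
      linarith
    linarith [nonneg_of_mul_nonneg_right h2 h]

theorem blockInner_diag_le {ι : Type*} [Fintype ι] {σ : ι → Type*}
    [∀ j, Fintype (σ j)] (y : ι → ∀ j, σ j → ℝ) :
    blockInner (fun i => y i i) (fun i => y i i) ≤ stackInner y y :=
  Finset.sum_le_sum fun i _ => Finset.single_le_sum (f := fun j => y i j ⬝ᵥ y i j)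
    (fun _ _ => dotProduct_self_nonneg_real _) (Finset.mem_univ i)

/-- Part of the Laplacian term that is guaranteed by a lower bound for the consensus weight which is
required only if there is a positive eigenvalue. -/
theorem Communicable.le_weight_mul_laplacian (h : Communicable G) {ρ K : ℝ}
    (hρ : 0 ≤ ρ) (hK : ∀ σ₁ : ℝ, IsLeast {s : ℝ | 0 < s ∧
      Module.End.HasEigenvalue (Matrix.toLin' G.laplacian) s} σ₁ → 2 / σ₁ * K ≤ ρ)
    {e : G.Stack} (he : ∑ i, e i = 0) :
    K * stackInner e e ≤ ρ / 2 * stackInner e (kron G.laplacian e) := by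
  have hfin : {s : ℝ | 0 < s ∧ Module.End.HasEigenvalue (Matrix.toLin' G.laplacian) s}.Finite :=
    (Module.End.finite_hasEigenvalue (Matrix.toLin' G.laplacian)).subset fun s hs => hs.2
  rcases Set.eq_empty_or_nonempty {s : ℝ | 0 < s ∧
      Module.End.HasEigenvalue (Matrix.toLin' G.laplacian) s} with hS | hS
  -- Without positive eigenvalues every real `s` is a lower bound of them, which is possible only if
  -- `e` has norm zero.
  · have h1 : ∀ s : ℝ, s * stackInner e e ≤ stackInner e (kron G.laplacian e) := fun s =>
      h.le_stackInner_laplacian (fun t ht ht' => by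
        have : t ∈ (∅ : Set ℝ) := hS ▸ ⟨ht, ht'⟩
        exact this.elim) he
    have h2 : stackInner e e = 0 := by
      by_contra hne
      have := h1 ((stackInner e (kron G.laplacian e) + 1) / stackInner e e)
      rw [div_mul_cancel₀ _ hne] at this
      linarith
    rw [h2, mul_zero]
    exact mul_nonneg (by linarith) (G.stackInner_laplacian_nonneg e)
  · obtain ⟨σ₁, hσ, hmin⟩ := Set.exists_min_image _ id hfin hS
    have h1 := hK σ₁ ⟨hσ, fun t ht => hmin t ht⟩
    have h2 := h.le_stackInner_laplacian (fun t ht ht' => hmin t ⟨ht, ht'⟩) he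
    simp only [id] at h2
    have h3 : K ≤ ρ / 2 * σ₁ := by
      have := mul_le_mul_of_nonneg_right h1 (half_pos hσ.1).le
      have e : 2 / σ₁ * K * (σ₁ / 2) = K := by
        have := hσ.1.ne'
        field_simp
      linarith
    calc K * stackInner e e ≤ ρ / 2 * σ₁ * stackInner e e :=
          mul_le_mul_of_nonneg_right h3 (stackInner_self_nonneg _)
      _ = ρ / 2 * (σ₁ * stackInner e e) := by ring
      _ ≤ _ := mul_le_mul_of_nonneg_left h2 (by linarith)

namespace ConvgLipschitz

variable {p : Params G}

theorem monotoneAt_const (h : ConvgLipschitz p) (hp : p.Admissible) (h1 : ScenarioObjectives G)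
    (h4 : Communicable G) (x : G.Profile) : p.MonotoneAt fun _ => x := by
  obtain ⟨η, θ₁, θ₂, hη, hθ₁, hθ₂, hF, hext, hρ⟩ := h
  intro y g hg g' hg'
  have hN : (N : ℝ) ≠ 0 := by
    obtain ⟨i⟩ := h4.connected.nonempty
    exact_mod_cast (Fin.pos i).ne'
  -- Split `y` into the average `c` and the disagreement `e`. A subgradient `f` at the consensus on
  -- `c` then separates the effect of `e`, controlled by `θ₂`, from that of `c - x`, controlled by
  -- `η` and `θ₁`.
  let c : G.Profile := (N : ℝ)⁻¹ • ∑ i, y i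
  let e : G.Stack := fun i => y i - c
  have he : ∑ i, e i = 0 := by
    simp only [e, Finset.sum_sub_distrib, Finset.sum_const, Finset.card_univ, Fintype.card_fin]
    rw [← Nat.cast_smul_eq_nsmul ℝ, smul_smul, mul_inv_cancel₀ hN, one_smul, sub_self]
  obtain ⟨f, hf⟩ := h1.extPseudograd_nonempty fun _ => c
  obtain ⟨hm, hl⟩ := hF c x f hf g' hg'
  have hgf := hext y (fun _ => c) g hg f hf
  have hρ' := h4.le_weight_mul_laplacian hp.ρμ_nonneg hρ he
  have hyc : y - (fun _ => c) = e := rfl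
  rw [hyc] at hgf
  have hdec : y - (fun _ => x) = e + fun _ => c - x := by
    ext1 i
    simp [e]
  have hlap : kron G.laplacian (y - fun _ => x) = kron G.laplacian e := by
    rw [hdec, kron_add, Game.kron_laplacian_const, add_zero]
  have hlap' : stackInner (fun _ => c - x) (kron G.laplacian e) = 0 := by
    rw [stackInner_kron, Game.laplacian_transpose, Game.kron_laplacian_const, stackInner_comm,
      stackInner_zero_right]
  rw [hlap, stackInner_add_right, Game.stackInner_selT, stackInner_smul_right, hdec,
    stackInner_add_left e _ (kron _ _), hlap', add_zero]
  have hdiag : (fun i => (e + fun _ => c - x : G.Stack) i i) = (fun i => e i i) + (c - x) := rfl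
  have hgg : g - g' = (g - f) + (f - g') := by abel
  rw [hdiag, hgg, blockInner_add_left, blockInner_add_right, blockInner_add_right]
  have b1 := (abs_le.1 (abs_blockInner_le (fun i => e i i) (g - f))).1
  have b2 := (abs_le.1 (abs_blockInner_le (fun i => e i i) (f - g'))).1
  have b3 := (abs_le.1 (abs_blockInner_le (c - x) (g - f))).1
  have hb : √(blockInner (fun i => e i i) fun i => e i i) ≤ √(stackInner e e) :=
    Real.sqrt_le_sqrt (blockInner_diag_le e)
  have ha2 : √(blockInner (c - x) (c - x)) ^ 2 = blockInner (c - x) (c - x) :=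
    Real.sq_sqrt (blockInner_self_nonneg _)
  have hb2 : √(stackInner e e) ^ 2 = stackInner e e := Real.sq_sqrt (stackInner_self_nonneg _)
  rw [← ha2] at hm
  rw [← hb2] at hρ'
  have ha0 := Real.sqrt_nonneg (blockInner (c - x) (c - x))
  have hb0 := Real.sqrt_nonneg (stackInner e e)
  generalize √(blockInner (c - x) (c - x)) = a at *
  generalize √(stackInner e e) = b at *
  have c1 : √(blockInner (fun i => e i i) fun i => e i i) * √(blockInner (g - f) (g - f))
      ≤ b * (θ₂ * b) := by gcongr
  have c2 : √(blockInner (fun i => e i i) fun i => e i i) * √(blockInner (f - g') (f - g'))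
      ≤ b * (θ₁ * a) := by gcongr
  have c3 : a * √(blockInner (g - f) (g - f)) ≤ a * (θ₂ * b) := by gcongr
  -- Completing the square explains the bound on `ρμ`: its first summand pays for the cross terms in
  -- `a * b`, and `θ₂` for the remaining `θ₂ * b ^ 2`.
  have key : 0 ≤ η * a ^ 2 - (θ₁ + θ₂) * (a * b) + (θ₁ + θ₂) ^ 2 / (4 * η) * b ^ 2 := by
    have : η * a ^ 2 - (θ₁ + θ₂) * (a * b) + (θ₁ + θ₂) ^ 2 / (4 * η) * b ^ 2
        = η * (a - (θ₁ + θ₂) / (2 * η) * b) ^ 2 := by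
      field_simp
      ring
    rw [this]
    positivity
  linarith

end ConvgLipschitz

/-! ### Continuity of the resolvent under the Lipschitz alternative. -/

theorem tendsto_of_tendsto_blockInner {α ι : Type*} [Fintype ι] {κ : ι → Type*}
    [∀ i, Fintype (κ i)] {l : Filter α} {F : α → ∀ i, κ i → ℝ} {c : ∀ i, κ i → ℝ}
    (h : Tendsto (fun q => blockInner (F q - c) (F q - c)) l (𝓝 0)) : Tendsto F l (𝓝 c) := by
  refine tendsto_pi_nhds.2 fun i => tendsto_pi_nhds.2 fun a => ?_
  rw [tendsto_iff_norm_sub_tendsto_zero]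
  have h1 : Tendsto (fun q => √(blockInner (F q - c) (F q - c))) l (𝓝 0) := by
    simpa using h.sqrt
  refine squeeze_zero (fun _ => norm_nonneg _) (fun q => ?_) h1
  refine Real.abs_le_sqrt ?_
  rw [sq]
  calc (F q i a - c i a) * (F q i a - c i a) ≤ (F q - c) i ⬝ᵥ (F q - c) i :=
        Finset.single_le_sum (f := fun a => (F q - c) i a * (F q - c) i a)
          (fun _ _ => mul_self_nonneg _) (Finset.mem_univ a)
    _ ≤ _ := Finset.single_le_sum (f := fun i => (F q - c) i ⬝ᵥ (F q - c) i)
          (fun _ _ => dotProduct_self_nonneg_real _) (Finset.mem_univ i)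

namespace Params

variable {p : Params G}

theorem continuous_Φ : Continuous p.Φ := by
  let f : G.Pt →ₗ[ℝ] G.Pt := { toFun := p.Φ, map_add' := p.Φ_add, map_smul' := p.Φ_smul }
  exact f.continuous_of_finiteDimensional

/-- The own block of a resolvent value depends Lipschitz continuously on the data of the proximal
step. -/
theorem resolvent_pA_own_le (hp : p.Admissible) {q q' r r' : G.Pt} (hr : r ∈ resolventSet p.pA q)
    {g' w' : G.Profile}
    (hw' : ∀ i, w' i ∈ normalCone dotProduct (Set.Icc (p.lo i) (p.hi i)) (r'.1 i i))
    (h' : p.Φ q' = p.lowerTri r' + (G.selT (g' + w'), p.cLoc, 0, 0)) (i : Fin N)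
    {f : Fin (G.n i) → ℝ} (hf : f ∈ G.partialSubdiff i (Function.update (r.1 i) i (r'.1 i i))) :
    (r.1 i i - r'.1 i i) ⬝ᵥ (r.1 i i - r'.1 i i) ≤ p.τ₁ i ^ 2 *
      (((p.Φ q).1 i i - (p.Φ q').1 i i - (f - g' i)) ⬝ᵥ
        ((p.Φ q).1 i i - (p.Φ q').1 i i - (f - g' i))) := by
  obtain ⟨g, hg, w, hw, h⟩ := mem_resolventSet_pA.1 hr
  have e1 : (p.Φ q).1 i i = (p.τ₁ i)⁻¹ • r.1 i i + (g i + w i) := by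
    have := congrFun (congrFun (congrArg Prod.fst h) i) i
    rw [this]
    simp [lowerTri, Game.selT_apply_self]
  have e2 : (p.Φ q').1 i i = (p.τ₁ i)⁻¹ • r'.1 i i + (g' i + w' i) := by
    have := congrFun (congrFun (congrArg Prod.fst h') i) i
    rw [this]
    simp [lowerTri, Game.selT_apply_self]
  have h3 := Game.partialSubdiff_monotone (fun j hj => by simp [hj]) (hg i) hf
  have h4 := normalCone_dotProduct_monotone (hw i) (hw' i)
  rw [Function.update_self] at h3
  have e3 : (p.Φ q).1 i i - (p.Φ q').1 i i - (f - g' i)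
      = (p.τ₁ i)⁻¹ • (r.1 i i - r'.1 i i) + ((g i - f) + (w i - w' i)) := by
    rw [e1, e2]
    module
  rw [e3]
  have hτ := hp.τ₁_pos i
  generalize r.1 i i - r'.1 i i = d at *
  generalize hz : (g i - f) + (w i - w' i) = z
  -- Monotonicity gives `⟨d, z⟩ ≥ 0`, so adding `z` to `τ₁⁻¹ • d` cannot shorten it.
  have hdz : 0 ≤ d ⬝ᵥ z := by
    rw [← hz, dotProduct_add]
    exact add_nonneg h3 h4
  have hzz := dotProduct_self_nonneg_real z
  simp only [dotProduct_add, add_dotProduct, dotProduct_smul, smul_dotProduct, smul_eq_mul,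
    dotProduct_comm z d]
  have e4 : p.τ₁ i ^ 2 * ((p.τ₁ i)⁻¹ * ((p.τ₁ i)⁻¹ * d ⬝ᵥ d) + (p.τ₁ i)⁻¹ * d ⬝ᵥ z +
      ((p.τ₁ i)⁻¹ * d ⬝ᵥ z + z ⬝ᵥ z))
      = d ⬝ᵥ d + (2 * p.τ₁ i * (d ⬝ᵥ z) + p.τ₁ i ^ 2 * (z ⬝ᵥ z)) := by
    field_simp
    ring
  have h5 : 0 ≤ 2 * p.τ₁ i * (d ⬝ᵥ z) + p.τ₁ i ^ 2 * (z ⬝ᵥ z) := by positivity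
  refine le_trans ?_ (e4.ge.trans (le_of_eq ?_))
  · linarith
  · ring

theorem resolvent_pA_of_ne (hp : p.Admissible) {q r : G.Pt} (hr : r ∈ resolventSet p.pA q)
    {i j : Fin N} (hj : j ≠ i) : r.1 i j = p.τ₁ i • (p.Φ q).1 i j := by
  obtain ⟨g, hg, w, hw, h⟩ := mem_resolventSet_pA.1 hr
  have := congrFun (congrFun (congrArg Prod.fst h) i) j
  rw [this]
  simp [lowerTri, Game.selT_apply_of_ne _ hj, smul_smul, mul_inv_cancel₀ (hp.τ₁_pos i).ne']

/-- Continuity of the decision part of the resolvent. -/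
theorem _root_.SGNEP.ConvgLipschitz.continuous_resolvent_fst (h : ConvgLipschitz p)
    (hp : p.Admissible) (h1 : ScenarioObjectives G) (hA : ∀ q, ∃! r, r ∈ resolventSet p.pA q) :
    Continuous fun q => (resolvent p.pA q).1 := by
  obtain ⟨η, θ₁, θ₂, hη, hθ₁, hθ₂, hF, hext, hρ⟩ := h
  refine continuous_iff_continuousAt.2 fun q₀ => ?_
  obtain ⟨g₀, hg₀, w₀, hw₀, e₀⟩ := mem_resolventSet_pA.1 (resolvent_mem hA q₀)
  let y₀ := (resolvent p.pA q₀).1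
  have hne : ∀ q i j, j ≠ i → (resolvent p.pA q).1 i j = p.τ₁ i • (p.Φ q).1 i j :=
    fun q i j hj => resolvent_pA_of_ne hp (resolvent_mem hA q) hj
  -- The own blocks are frozen at their values for `q₀`. The others depend linearly on `q`, so `Y`
  -- is continuous before anything is known about the own blocks, and the Lipschitz bound makes the
  -- subgradients at `Y q` converge.
  let Y : G.Pt → G.Stack := fun q i =>
    Function.update ((resolvent p.pA q).1 i) i (y₀ i i)
  have hΦ : ∀ i j, Continuous fun q => (p.Φ q).1 i j := fun i j =>
    (continuous_apply j).comp ((continuous_apply i).comp (continuous_fst.comp continuous_Φ))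
  have hY : Continuous Y := by
    refine continuous_pi fun i => continuous_pi fun j => ?_
    by_cases hj : j = i
    · subst hj
      simpa [Y] using continuous_const
    · simp only [Y, Function.update_of_ne hj, hne _ _ _ hj]
      exact (hΦ i j).const_smul (p.τ₁ i)
  have hY₀ : Y q₀ = y₀ := by
    ext1 i
    simp [Y, y₀]
  choose f hf using fun q => h1.extPseudograd_nonempty (Y q)
  have hflim : Tendsto f (𝓝 q₀) (𝓝 g₀) := by
    refine tendsto_of_tendsto_blockInner ?_
    have h2 : Tendsto (fun q => θ₂ ^ 2 * stackInner (Y q - y₀) (Y q - y₀)) (𝓝 q₀) (𝓝 0) := by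
      have hc : Continuous fun q => θ₂ ^ 2 * stackInner (Y q - y₀) (Y q - y₀) := by
        unfold stackInner blockInner dotProduct
        fun_prop
      have := hc.tendsto q₀
      simpa [hY₀, stackInner_zero_right] using this
    refine squeeze_zero (fun _ => blockInner_self_nonneg _) (fun q => ?_) h2
    have h3 := hext (Y q) y₀ (f q) (hf q) g₀ hg₀
    have h4 := pow_le_pow_left₀ (Real.sqrt_nonneg _) h3 2
    rwa [mul_pow, Real.sq_sqrt (blockInner_self_nonneg _),
      Real.sq_sqrt (stackInner_self_nonneg _)] at h4
  have hown : ∀ i, Tendsto (fun q => (resolvent p.pA q).1 i i) (𝓝 q₀) (𝓝 (y₀ i i)) := by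
    intro i
    have h2 : Tendsto (fun q => p.τ₁ i ^ 2 *
        (((p.Φ q).1 i i - (p.Φ q₀).1 i i - (f q i - g₀ i)) ⬝ᵥ
          ((p.Φ q).1 i i - (p.Φ q₀).1 i i - (f q i - g₀ i)))) (𝓝 q₀) (𝓝 0) := by
      have h3 : Tendsto (fun q => (p.Φ q).1 i i - (p.Φ q₀).1 i i - (f q i - g₀ i)) (𝓝 q₀)
          (𝓝 ((p.Φ q₀).1 i i - (p.Φ q₀).1 i i - (g₀ i - g₀ i))) :=
        (((hΦ i i).tendsto q₀).sub_const _).sub (((tendsto_pi_nhds.1 hflim) i).sub_const _)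
      have h4 : Continuous fun z : Fin (G.n i) → ℝ => p.τ₁ i ^ 2 * (z ⬝ᵥ z) := by
        unfold dotProduct
        fun_prop
      have h5 := (h4.tendsto _).comp h3
      simpa [Function.comp_def] using h5
    have h6 := tendsto_of_tendsto_blockInner (ι := Unit) (κ := fun _ => Fin (G.n i))
      (F := fun q _ => (resolvent p.pA q).1 i i) (c := fun _ => y₀ i i) (l := 𝓝 q₀) (by
        refine squeeze_zero (fun _ => blockInner_self_nonneg _) (fun q => ?_) h2
        have := resolvent_pA_own_le hp (resolvent_mem hA q) hw₀ e₀ i (hf q i)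
        simpa [blockInner] using this)
    exact tendsto_pi_nhds.1 h6 ()
  refine tendsto_pi_nhds.2 fun i => tendsto_pi_nhds.2 fun j => ?_
  by_cases hj : j = i
  · subst hj
    exact hown j
  · simp only [hne _ _ _ hj]
    exact ((hΦ i j).const_smul (p.τ₁ i)).tendsto q₀

theorem continuous_kron {ι κ V : Type*} [Fintype κ] [AddCommGroup V] [Module ℝ V]
    [TopologicalSpace V] [ContinuousAdd V] [ContinuousConstSMul ℝ V] (M : Matrix ι κ ℝ) :
    Continuous fun v : κ → V => kron M v := by
  unfold kron
  fun_prop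

theorem continuous_ΛR : Continuous G.ΛR := by
  unfold Game.ΛR Matrix.mulVec dotProduct
  fun_prop

/-- Forward substitution expresses the remaining blocks explicitly and continuously through `Φ q`
and the decision block. -/
theorem continuous_resolvent_pA_of_fst (hp : p.Admissible)
    (hA : ∀ q, ∃! r, r ∈ resolventSet p.pA q)
    (hy : Continuous fun q => (resolvent p.pA q).1) : Continuous (resolvent p.pA) := by
  have hΦ := p.continuous_Φ
  have hcomp : ∀ q, ∃ g ∈ G.extPseudograd (resolvent p.pA q).1, ∃ w : G.Profile,
      (∀ i, w i ∈ normalCone dotProduct (Set.Icc (p.lo i) (p.hi i)) ((resolvent p.pA q).1 i i)) ∧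
      p.Φ q = p.lowerTri (resolvent p.pA q) + (G.selT (g + w), p.cLoc, 0, 0) := fun q =>
    mem_resolventSet_pA.1 (resolvent_mem hA q)
  have h2 : ∀ q, (resolvent p.pA q).2.1 = fun i =>
      p.τ₂ i • ((p.Φ q).2.1 i + G.ΛR (resolvent p.pA q).1 i - p.cLoc i) := by
    intro q
    obtain ⟨g, -, w, -, e⟩ := hcomp q
    ext1 i
    have := congrFun (congrArg (fun z : G.Pt => z.2.1) e) i
    rw [this]
    have key : ∀ a b c : Fin m → ℝ, a - b + c + b - c = a := fun a b c => by abel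
    simp [lowerTri, key, smul_smul, mul_inv_cancel₀ (hp.τ₂_pos i).ne']
  have h3 : ∀ q, (resolvent p.pA q).2.2.1 = fun i =>
      p.τ₃ i • ((p.Φ q).2.2.1 i + kron G.incidenceᵀ (resolvent p.pA q).1 i) := by
    intro q
    obtain ⟨g, -, w, -, e⟩ := hcomp q
    ext1 i
    have := congrFun (congrArg (fun z : G.Pt => z.2.2.1) e) i
    rw [this]
    simp [lowerTri, smul_smul, mul_inv_cancel₀ (hp.τ₃_pos i).ne']
  have h4 : ∀ q, (resolvent p.pA q).2.2.2 = fun i =>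
      p.τ₄ i • ((p.Φ q).2.2.2 i + kron G.incidenceᵀ (resolvent p.pA q).2.1 i) := by
    intro q
    obtain ⟨g, -, w, -, e⟩ := hcomp q
    ext1 i
    have := congrFun (congrArg (fun z : G.Pt => z.2.2.2) e) i
    rw [this]
    simp [lowerTri, smul_smul, mul_inv_cancel₀ (hp.τ₄_pos i).ne']
  have hl : Continuous fun q => (resolvent p.pA q).2.1 := by
    simp only [h2]
    exact continuous_pi fun i => ((((continuous_apply i).comp
      (continuous_fst.comp (continuous_snd.comp hΦ))).add
        ((continuous_apply i).comp (continuous_ΛR.comp hy))).sub continuous_const).const_smul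
          (p.τ₂ i)
  have hm : Continuous fun q => (resolvent p.pA q).2.2.1 := by
    simp only [h3]
    exact continuous_pi fun i => (((continuous_apply i).comp
      (continuous_fst.comp (continuous_snd.comp (continuous_snd.comp hΦ)))).add
        ((continuous_apply i).comp ((continuous_kron G.incidenceᵀ).comp hy))).const_smul (p.τ₃ i)
  have hz : Continuous fun q => (resolvent p.pA q).2.2.2 := by
    simp only [h4]
    exact continuous_pi fun i => (((continuous_apply i).comp
      (continuous_snd.comp (continuous_snd.comp (continuous_snd.comp hΦ)))).add
        ((continuous_apply i).comp ((continuous_kron G.incidenceᵀ).comp hl))).const_smul (p.τ₄ i)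
  exact hy.prodMk (hl.prodMk (hm.prodMk hz))

end Params

/-! ### Lagrange multipliers -/

namespace Game

theorem coupling_add (x y : G.Profile) : G.coupling (x + y) = G.coupling x + G.coupling y := by
  simp [coupling, Matrix.mulVec_add, Finset.sum_add_distrib]

theorem coupling_smul (a : ℝ) (x : G.Profile) : G.coupling (a • x) = a • G.coupling x := by
  simp [coupling, Matrix.mulVec_smul, Finset.smul_sum]

theorem coupling_sub (x y : G.Profile) : G.coupling (x - y) = G.coupling x - G.coupling y := by
  simp [coupling, Matrix.mulVec_sub, Finset.sum_sub_distrib]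

theorem dotProduct_coupling (l : Fin m → ℝ) (x : G.Profile) :
    l ⬝ᵥ G.coupling x = blockInner x fun i => (G.A i)ᵀ *ᵥ l := by
  rw [coupling, dotProduct_sum]
  refine Finset.sum_congr rfl fun i _ => ?_
  simp only
  rw [Matrix.dotProduct_mulVec, Matrix.mulVec_transpose, dotProduct_comm]

end Game

theorem nonneg_of_forall_mul_add {a b : ℝ} (h : ∀ r : ℝ, 0 ≤ r → 0 ≤ r * a + b) : 0 ≤ a := by
  by_contra! ha
  have := h ((|b| + 1) / (-a)) (div_nonneg (by positivity) (by linarith))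
  have e : (|b| + 1) / (-a) * a = -(|b| + 1) := by
    have := ha.ne
    field_simp
  linarith [le_abs_self b]

/-- Fritz John multipliers of the minimization of a linear function over the collective feasible
set. -/
theorem FeasibleSets.exists_fritzJohn (h2 : FeasibleSets G) {x g : G.Profile}
    (hx : x ∈ G.feasible) (hg : ∀ x' ∈ G.feasible, 0 ≤ blockInner (x' - x) g) :
    ∃ (α : ℝ) (l : Fin m → ℝ), 0 ≤ α ∧ (∀ a, 0 ≤ l a) ∧ (α ≠ 0 ∨ l ≠ 0) ∧
      ∀ x' ∈ G.prodX, 0 ≤ α * blockInner (x' - x) g + l ⬝ᵥ (G.coupling x' - G.c) := by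
  have hO : IsOpen {z : ℝ × (Fin m → ℝ) | z.1 < 0 ∧ ∀ a, z.2 a < 0} := by
    have : {z : ℝ × (Fin m → ℝ) | z.1 < 0 ∧ ∀ a, z.2 a < 0}
        = {z | z.1 < 0} ∩ ⋂ a, {z | z.2 a < 0} := by
      ext z
      simp
    rw [this]
    exact (isOpen_lt (by fun_prop) (by fun_prop)).inter
      (isOpen_iInter_of_finite fun a => isOpen_lt (by fun_prop) (by fun_prop))
  have hOc : Convex ℝ {z : ℝ × (Fin m → ℝ) | z.1 < 0 ∧ ∀ a, z.2 a < 0} := by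
    have hc : ∀ {u v a b : ℝ}, u < 0 → v < 0 → 0 ≤ a → 0 ≤ b → a + b = 1 → a * u + b * v < 0 := by
      intro u v a b hu hv ha hb hab
      have := convex_Iio (0 : ℝ) (Set.mem_Iio.2 hu) (Set.mem_Iio.2 hv) ha hb hab
      simpa using this
    rintro ⟨t, s⟩ ⟨h1, h1'⟩ ⟨t', s'⟩ ⟨h3, h3'⟩ a b ha hb hab
    exact ⟨hc h1 h3 ha hb hab, fun l => hc (h1' l) (h3' l) ha hb hab⟩
  have hSc : Convex ℝ {z : ℝ × (Fin m → ℝ) | ∃ x' ∈ G.prodX, blockInner (x' - x) g ≤ z.1 ∧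
      ∀ a, G.coupling x' a - G.c a ≤ z.2 a} := by
    rintro ⟨t, s⟩ ⟨y, hy, h1, h1'⟩ ⟨t', s'⟩ ⟨y', hy', h3, h3'⟩ a b ha hb hab
    refine ⟨a • y + b • y', fun i => h2.convex i (hy i) (hy' i) ha hb hab, ?_, fun l => ?_⟩
    · have e : a • y + b • y' - x = a • (y - x) + b • (y' - x) := by
        have : x = (a + b) • x := by rw [hab, one_smul]
        conv_lhs => rw [this]
        module
      rw [e, blockInner_comm, blockInner_add_right, blockInner_smul_right, blockInner_smul_right,
        blockInner_comm g, blockInner_comm g]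
      exact add_le_add (mul_le_mul_of_nonneg_left h1 ha) (mul_le_mul_of_nonneg_left h3 hb)
    · have e : G.coupling (a • y + b • y') l - G.c l
          = a * (G.coupling y l - G.c l) + b * (G.coupling y' l - G.c l) := by
        rw [Game.coupling_add, Game.coupling_smul, Game.coupling_smul]
        simp only [Pi.add_apply, Pi.smul_apply, smul_eq_mul]
        linear_combination (G.c l) * hab
      rw [e]
      exact add_le_add (mul_le_mul_of_nonneg_left (h1' l) ha) (mul_le_mul_of_nonneg_left (h3' l) hb)
  -- Separate the open negative orthant from the attainable upper bounds of objective and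
  -- constraints; a common point would be feasible with a negative objective increment.
  obtain ⟨F, u, hF1, hF2⟩ := geometric_hahn_banach_open hOc hO hSc (by
    rw [Set.disjoint_left]
    rintro ⟨t, s⟩ ⟨h1, h1'⟩ ⟨y, hy, h3, h3'⟩
    have := hg y ⟨hy, fun l => by linarith [h1' l, h3' l]⟩
    linarith)
  obtain ⟨l, hl⟩ := linearMap_eq_dotProduct (F.toLinearMap ∘ₗ LinearMap.inr ℝ ℝ (Fin m → ℝ))
  have hF : ∀ t s, F (t, s) = F (1, 0) * t + l ⬝ᵥ s := by
    intro t s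
    have : ((t, s) : ℝ × (Fin m → ℝ)) = t • (1, 0) + (0, s) := by simp
    rw [this, map_add, map_smul, ← hl]
    simp [mul_comm]
  have hxS : ∀ (r : ℝ) (s : Fin m → ℝ), 0 ≤ r → (∀ a, 0 ≤ s a) →
      u ≤ F (1, 0) * r + l ⬝ᵥ (G.coupling x - G.c + s) := by
    intro r s hr hs
    rw [← hF]
    refine hF2 _ ⟨x, hx.1, ?_, fun a => ?_⟩
    · rw [sub_self, blockInner_comm, blockInner_zero_right]
      exact hr
    · simpa using hs a
  -- The origin is a limit of points of the open orthant.
  have hu : 0 ≤ u := by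
    refine nonneg_of_forall_quadratic (M := F (1, 1)) fun s hs _ => ?_
    have h1 := hF1 ((-s) • (1, 1)) ⟨by simpa using hs, fun a => by simpa using hs⟩
    rw [map_smul, smul_eq_mul] at h1
    have h3 : 0 ≤ s * (u - -s * F (1, 1)) := mul_nonneg hs.le (by linarith)
    linarith
  have hne : F (-1, -1) < u := hF1 _ ⟨by simp, fun a => by simp⟩
  rw [hF] at hne
  generalize hα : F (1, 0) = α at *
  refine ⟨α, l, ?_, fun a => ?_, ?_, fun x' hx' => ?_⟩
  · refine nonneg_of_forall_mul_add (b := l ⬝ᵥ (G.coupling x - G.c)) fun r hr => ?_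
    have := hxS r 0 hr fun _ => le_rfl
    rw [add_zero] at this
    linarith
  · refine nonneg_of_forall_mul_add (b := l ⬝ᵥ (G.coupling x - G.c)) fun r hr => ?_
    have := hxS 0 (Pi.single a r) le_rfl fun b => by
      by_cases hb : b = a
      · subst hb; simpa using hr
      · simp [hb]
    rw [dotProduct_add, dotProduct_single] at this
    linarith
  · by_contra! hcon
    rw [hcon.1, hcon.2] at hne
    have := hxS 0 0 le_rfl fun _ => le_rfl
    rw [hcon.1, hcon.2] at this
    simp only [zero_mul, zero_dotProduct, add_zero] at this hne
    linarith
  · rw [← hF]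
    exact hu.trans (hF2 _ ⟨x', hx', le_rfl, fun _ => le_rfl⟩)

/-- Under the constraint qualification the multipliers are normal. -/
theorem FeasibleSets.exists_multiplier (h2 : FeasibleSets G) {x g : G.Profile}
    (hx : x ∈ G.feasible) (hg : ∀ x' ∈ G.feasible, 0 ≤ blockInner (x' - x) g) :
    ∃ l : Fin m → ℝ, (∀ a, 0 ≤ l a) ∧ l ⬝ᵥ (G.coupling x - G.c) = 0 ∧
      ∀ x' ∈ G.prodX, 0 ≤ blockInner (x' - x) g + l ⬝ᵥ (G.coupling x' - G.coupling x) := by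
  obtain ⟨α, l, hα, hl, hne, hmin⟩ := h2.exists_fritzJohn hx hg
  have hterm : ∀ a ∈ Finset.univ, l a * (G.coupling x - G.c) a ≤ 0 := fun a _ =>
    mul_nonpos_of_nonneg_of_nonpos (hl a) (sub_nonpos.2 (hx.2 a))
  have hcs : l ⬝ᵥ (G.coupling x - G.c) = 0 := by
    refine le_antisymm (Finset.sum_nonpos hterm) ?_
    have := hmin x hx.1
    rwa [sub_self, blockInner_comm, blockInner_zero_right, mul_zero, zero_add] at this
  have hmin' : ∀ x' ∈ G.prodX,
      0 ≤ α * blockInner (x' - x) g + l ⬝ᵥ (G.coupling x' - G.coupling x) := by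
    intro x' hx'
    have h1 := hmin x' hx'
    have e : G.coupling x' - G.coupling x = (G.coupling x' - G.c) - (G.coupling x - G.c) := by abel
    rw [e, dotProduct_sub, hcs, sub_zero]
    exact h1
  -- If `α` vanished, `x` would minimize `l ⬝ᵥ G.coupling` over the local sets, so `l ⬝ᵥ G.coupling
  -- h ≥ 0`. By complementarity `l` lives on active constraints, where `h` strictly decreases, so
  -- `l` would vanish too.
  have hα' : 0 < α := by
    refine hα.lt_of_ne' fun h0 => ?_
    obtain ⟨h, hT, hact⟩ := h2.mfcq x hx
    let φ : G.Profile →ₗ[ℝ] ℝ :=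
      { toFun := fun y => l ⬝ᵥ G.coupling y
        map_add' := fun y z => by rw [Game.coupling_add, dotProduct_add]
        map_smul' := fun a y => by rw [Game.coupling_smul, dotProduct_smul]; rfl }
    have hφ : IsLocalMinOn φ.toContinuousLinearMap G.prodX x := by
      refine IsMinOn.localize fun y hy => ?_
      have := hmin' y hy
      rw [h0, zero_mul, zero_add, dotProduct_sub] at this
      exact sub_nonneg.1 this
    have h3 : 0 ≤ l ⬝ᵥ G.coupling h := hφ.hasFDerivWithinAt_nonneg
      φ.toContinuousLinearMap.hasFDerivAt.hasFDerivWithinAt hT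
    have h4 := (Finset.sum_eq_zero_iff_of_nonpos hterm).1 hcs
    have h5 : ∀ a, l a ≠ 0 → G.coupling h a < 0 := fun a ha => by
      have := (mul_eq_zero.1 (h4 a (Finset.mem_univ a))).resolve_left ha
      exact hact a (sub_eq_zero.1 this)
    have h6 : ∀ a ∈ Finset.univ, l a * G.coupling h a ≤ 0 := fun a _ => by
      by_cases ha : l a = 0
      · simp [ha]
      · exact mul_nonpos_of_nonneg_of_nonpos (hl a) (h5 a ha).le
    have h7 := (Finset.sum_eq_zero_iff_of_nonpos h6).1 (le_antisymm (Finset.sum_nonpos h6) h3)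
    refine hne.elim (fun h => h h0) fun h => h (funext fun a => ?_)
    by_contra ha
    exact (h5 a ha).ne ((mul_eq_zero.1 (h7 a (Finset.mem_univ a))).resolve_left ha)
  refine ⟨α⁻¹ • l, fun a => mul_nonneg (inv_pos.2 hα').le (hl a), ?_, fun x' hx' => ?_⟩
  · rw [smul_dotProduct, hcs, smul_zero]
  · have := mul_nonneg (inv_pos.2 hα').le (hmin' x' hx')
    rw [mul_add, inv_mul_cancel_left₀ hα'.ne'] at this
    rwa [smul_dotProduct, smul_eq_mul]

/-! ### Zeros of the operator `𝕋` -/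

namespace Params

variable {p : Params G}

theorem exists_zero_mem_opT (hp : p.Admissible) (h2 : FeasibleSets G) (h4 : Communicable G)
    {x : G.Profile} (hx : G.IsVSGNE x) : ∃ ψ, 0 ∈ p.opT ψ := by
  obtain ⟨hxf, g, hg, hvi⟩ := hx
  obtain ⟨l, hl, hcs, hmin⟩ := h2.exists_multiplier hxf hvi
  have hN : (N : ℝ) ≠ 0 := by
    obtain ⟨i⟩ := h4.connected.nonempty
    exact_mod_cast (Fin.pos i).ne'
  -- The slack is shared equally among the players. What then remains of the local rows sums to zero
  -- over the network and is balanced by `z`; the decision rows balance blockwise with zero edge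
  -- variables.
  let v : Fin m → ℝ := (N : ℝ)⁻¹ • (G.coupling x - G.c)
  have hv : v ∈ normalCone dotProduct {l : Fin m → ℝ | ∀ a, 0 ≤ l a} l := by
    refine Game.mem_normalCone_nonneg.2 ⟨hl, fun a => ?_, ?_⟩
    · exact mul_nonpos_of_nonneg_of_nonpos (by positivity) (sub_nonpos.2 (hxf.2 a))
    · rw [smul_dotProduct, dotProduct_comm, hcs, smul_zero]
  obtain ⟨z, hz⟩ := h4.exists_kron_incidence (s := fun i => G.A i *ᵥ x i - p.cLoc i - v) (by
    rw [Finset.sum_sub_distrib, Finset.sum_sub_distrib, hp.sum_cLoc, Finset.sum_const,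
      Finset.card_univ, Fintype.card_fin, ← Nat.cast_smul_eq_nsmul ℝ, smul_smul,
      mul_inv_cancel₀ hN, one_smul]
    exact sub_self _)
  let w : G.Profile := fun i => -(g i + (G.A i)ᵀ *ᵥ l)
  have hw : ∀ i, w i ∈ normalCone dotProduct (G.X i) (x i) := by
    refine fun i => ⟨hxf.1 i, fun s hs => ?_⟩
    have h1 := hmin (Function.update x i s) (fun j => by
      by_cases hj : j = i
      · subst hj; simpa using hs
      · simpa [hj] using hxf.1 j)
    have e : Function.update x i s - x = Pi.single i (s - x i) := by
      ext1 j
      by_cases hj : j = i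
      · subst hj; simp
      · simp [hj]
    have e2 : ∀ f : G.Profile, blockInner (Pi.single i (s - x i)) f = (s - x i) ⬝ᵥ f i := by
      intro f
      rw [blockInner, Finset.sum_eq_single i]
      · simp
      · intro j _ hj
        simp [hj]
      · simp
    rw [← Game.coupling_sub, Game.dotProduct_coupling, e, e2, e2, ← dotProduct_add] at h1
    rw [neg_dotProduct, dotProduct_comm]
    linarith
  refine ⟨(fun _ => x, fun _ => l, 0, z), g, hg, G.selT w, mem_normalCone_extSet.2 ⟨w, rfl, hw⟩,
    fun _ => v, ⟨fun _ => hl, fun s hs => Finset.sum_nonpos fun i _ => hv.2 (s i) (hs i)⟩, ?_⟩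
  have hk0 : kron G.incidence (0 : G.Edge → G.Profile) = 0 := by
    ext1 i
    simp [kron]
  rw [Game.kron_laplacian_const, Game.kron_laplacian_const, Game.kron_incidence_transpose_const,
    Game.kron_incidence_transpose_const, hk0, hz]
  refine Prod.ext ?_ (Prod.ext ?_ (Prod.ext ?_ ?_))
  · have e : g + (fun i => (G.A i)ᵀ *ᵥ l) + w = 0 := by
      ext1 i
      simp [w]
    have e0 : G.selT (0 : G.Profile) = 0 := by
      ext1 i
      simp [Game.selT]
    simp only [Game.ΛRT, smul_zero, add_zero]
    rw [← Game.selT_add, ← Game.selT_add, e, e0]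
    rfl
  · ext1 i
    simp only [Game.ΛR, Pi.add_apply, Pi.sub_apply, smul_zero, Prod.fst_zero, Prod.snd_zero,
      Pi.zero_apply]
    abel
  · simp
  · simp

/-- Pairing stationarity with `x' - x`, the normal vectors contribute with the right sign, and so
does the multiplier, by complementarity and feasibility of `x'`. -/
theorem isVSGNE_of_isKKT {x : G.Profile} {l : Fin m → ℝ} (h : G.IsKKT x l) : G.IsVSGNE x := by
  obtain ⟨h1, v, hv, h3⟩ := h
  choose g hg w hw hgw using h1
  have hv' : v = G.coupling x - G.c := by
    rw [neg_add_eq_zero] at h3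
    exact h3.symm
  obtain ⟨hl, hvn, hvl⟩ := Game.mem_normalCone_nonneg.1 hv
  rw [hv'] at hvn hvl
  refine ⟨⟨fun i => (hw i).1, fun a => sub_nonpos.1 (hvn a)⟩, g, hg, fun x' hx' => ?_⟩
  have e : g = -((fun i => (G.A i)ᵀ *ᵥ l) + w) := by
    ext1 i
    exact eq_neg_of_add_eq_zero_left (by rw [← hgw i]; simp [add_assoc])
  rw [e, blockInner_neg_right, blockInner_add_right, ← Game.dotProduct_coupling,
    Game.coupling_sub]
  have h4 : blockInner (x' - x) w ≤ 0 := Finset.sum_nonpos fun i _ => by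
    rw [dotProduct_comm]
    exact (hw i).2 _ (hx'.1 i)
  have h5 : l ⬝ᵥ (G.coupling x' - G.c) ≤ 0 := Finset.sum_nonpos fun a _ =>
    mul_nonpos_of_nonneg_of_nonpos (hl a) (sub_nonpos.2 (hx'.2 a))
  have h6 : l ⬝ᵥ (G.coupling x' - G.coupling x)
      = l ⬝ᵥ (G.coupling x' - G.c) - (G.coupling x - G.c) ⬝ᵥ l := by
    rw [dotProduct_comm _ l, ← dotProduct_sub]
    congr 1
    abel
  rw [h6, hvl]
  linarith

/-- Zeros of `𝕋` are consensual and solve the KKT system. -/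
theorem consensus_of_zero_mem_opT (hp : p.Admissible) (h4 : Communicable G) {ψ : G.Pt}
    (hψ : 0 ∈ p.opT ψ) : ∃ (x : G.Profile) (l : Fin m → ℝ), (∀ i, ψ.1 i = x) ∧
      (∀ i, ψ.2.1 i = l) ∧ G.IsVSGNE x ∧ G.IsKKT x l := by
  obtain ⟨g, hg, u, hu, v, hv, h⟩ := hψ
  obtain ⟨w, rfl, hw⟩ := mem_normalCone_extSet.1 hu
  obtain ⟨i₀⟩ := h4.connected.nonempty
  have r1 := congrArg Prod.fst h
  have r2 := congrArg (fun z : G.Pt => z.2.1) h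
  have r3 := congrArg (fun z : G.Pt => z.2.2.1) h
  have r4 := congrArg (fun z : G.Pt => z.2.2.2) h
  simp only [Prod.fst_zero, Prod.snd_zero] at r1 r2 r3 r4
  have hy : ∀ i, ψ.1 i = ψ.1 i₀ := fun i =>
    h4.eq_of_kron_incidence_transpose (neg_eq_zero.1 r3.symm) i i₀
  have hl : ∀ i, ψ.2.1 i = ψ.2.1 i₀ := fun i =>
    h4.eq_of_kron_incidence_transpose (neg_eq_zero.1 r4.symm) i i₀
  have hKKT : G.IsKKT (ψ.1 i₀) (ψ.2.1 i₀) := by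
    refine ⟨fun j => ⟨g j, ?_, w j, ?_, ?_⟩, ∑ i, v i, ?_, ?_⟩
    · rw [← hy j]
      exact hg j
    · have := hw j
      rwa [hy j] at this
    -- Summation over the players removes all network terms; in block `j` of the sum only the own
    -- row of player `j` is left.
    · have h1 : ∑ i, (0 : G.Stack) i = _ := Finset.sum_congr rfl fun i _ => congrFun r1 i
      simp only [Pi.add_apply, Finset.sum_add_distrib, Game.sum_kron_incidence, Pi.smul_apply,
        ← Finset.smul_sum, Game.sum_kron_laplacian, smul_zero, add_zero, Pi.zero_apply,
        Finset.sum_const_zero] at h1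
      have h3 := congrFun h1 j
      have hsel : ∀ s : G.Profile, (∑ i, G.selT s i) j = s j := by
        intro s
        rw [Finset.sum_apply, Finset.sum_eq_single j]
        · exact Game.selT_apply_self s j
        · intro i _ hi
          exact Game.selT_apply_of_ne s hi.symm
        · simp
      rw [Pi.add_apply, Pi.add_apply, Game.ΛRT, hsel, hsel, hsel, hl j] at h3
      exact h3.symm
    · refine ⟨fun a => hv.1 i₀ a, fun z hz => ?_⟩
      rw [sum_dotProduct]
      refine Finset.sum_nonpos fun i _ => ?_
      rw [← hl i]
      exact (Game.mem_normalCone_nonnegDual hv i).2 z hz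
    · have h1 : ∑ i, (0 : Fin N → Fin m → ℝ) i = _ := Finset.sum_congr rfl fun i _ => congrFun r2 i
      simp only [Pi.add_apply, Pi.sub_apply, Finset.sum_add_distrib, Finset.sum_sub_distrib,
        Game.sum_kron_incidence, Pi.smul_apply, ← Finset.smul_sum, Game.sum_kron_laplacian,
        smul_zero, add_zero, Pi.zero_apply, Finset.sum_const_zero, hp.sum_cLoc] at h1
      have h3 : ∑ i, G.ΛR ψ.1 i = G.coupling (ψ.1 i₀) :=
        Finset.sum_congr rfl fun i _ => by rw [Game.ΛR, hy i]
      rw [h3] at h1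
      rw [h1]
      abel
  exact ⟨_, _, hy, hl, isVSGNE_of_isKKT hKKT, hKKT⟩

end Params

/-! ### The Douglas–Rachford operator -/

namespace Params

variable {p : Params G}

/-- The metric of the design matrix is Euclidean. -/
theorem exists_continuousLinearEquiv (h6 : DesignPosDef p) :
    ∃ (n : ℕ) (e : G.Pt ≃L[ℝ] EuclideanSpace ℝ (Fin n)),
      (∀ x, ‖e x‖ ^ 2 = p.formK x x) ∧ ∀ x, ‖e x‖ = p.normK x := by
  obtain ⟨n, e, he⟩ := exists_linearEquiv_euclideanSpace p.formK p.formK_comm h6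
  refine ⟨n, e.toContinuousLinearEquiv, fun x => ?_, fun x => ?_⟩
  · rw [← real_inner_self_eq_norm_sq]
    exact he x x
  · rw [norm_eq_sqrt_real_inner, normK]
    exact congrArg _ (he x x)

theorem continuous_of_formK_le (h6 : DesignPosDef p) {T : G.Pt → G.Pt}
    (hT : ∀ q q', p.formK (T q - T q') (T q - T q') ≤ p.formK (q - q') (q - q')) :
    Continuous T := by
  obtain ⟨n, e, he, -⟩ := exists_continuousLinearEquiv h6
  have hL : LipschitzWith 1 fun z => e (T (e.symm z)) := by
    refine LipschitzWith.mk_one fun z z' => ?_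
    rw [dist_eq_norm, dist_eq_norm, ← map_sub]
    refine (sq_le_sq₀ (norm_nonneg _) (norm_nonneg _)).1 ?_
    have h := hT (e.symm z) (e.symm z')
    rw [← he, ← he, ← map_sub, e.apply_symm_apply] at h
    exact h
  have h : T = fun q => e.symm ((fun z => e (T (e.symm z))) (e q)) := by
    ext1 q
    simp
  rw [h]
  exact e.symm.continuous.comp (hL.continuous.comp e.continuous)

/-- Under monotonicity the reflected resolvent is nonexpansive. In the Lipschitz case monotonicity
is at hand only at consensual points, so the block structure is used instead. -/
theorem continuous_resolvent_pA (hp : p.Admissible) (h1 : ScenarioObjectives G)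
    (h5 : ConvgMonotone p ∨ ConvgLipschitz p) (h6 : DesignPosDef p)
    (hA : ∀ q, ∃! r, r ∈ resolventSet p.pA q) : Continuous (resolvent p.pA) := by
  rcases h5 with h | h
  · have hR : Continuous (reflectedResolvent p.pA) := continuous_of_formK_le h6 fun q q' =>
      reflectedResolvent_pA_le hp hA q q' (h.monotoneAt _)
    have e : resolvent p.pA = fun q => (1 / 2 : ℝ) • (reflectedResolvent p.pA q + q) := by
      ext1 q
      rw [reflectedResolvent]
      module
    rw [e]
    exact (hR.add continuous_id).const_smul (1 / 2 : ℝ)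
  · exact continuous_resolvent_pA_of_fst hp hA (h.continuous_resolvent_fst hp h1 hA)

theorem continuous_reflectedResolvent {V : Type*} [AddCommGroup V] [TopologicalSpace V]
    [IsTopologicalAddGroup V] {T : V → Set V} (h : Continuous (resolvent T)) :
    Continuous (reflectedResolvent T) :=
  (h.const_smul 2).sub continuous_id

theorem monotoneAt_of_zero_mem_opT (hp : p.Admissible) (h1 : ScenarioObjectives G)
    (h4 : Communicable G) (h5 : ConvgMonotone p ∨ ConvgLipschitz p) {ψ : G.Pt}
    (hψ : 0 ∈ p.opT ψ) : p.MonotoneAt ψ.1 := by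
  rcases h5 with h | h
  · exact h.monotoneAt _
  · obtain ⟨x, l, hx, -⟩ := consensus_of_zero_mem_opT hp h4 hψ
    rw [show ψ.1 = fun _ => x from funext hx]
    exact h.monotoneAt_const hp h1 h4 x

/-- The Douglas–Rachford operator does not move points away from its fixed points. -/
theorem formK_Rstar_sub_le (hp : p.Admissible) (h1 : ScenarioObjectives G) (h4 : Communicable G)
    (h5 : ConvgMonotone p ∨ ConvgLipschitz p) (hA : ∀ q, ∃! r, r ∈ resolventSet p.pA q)
    (hB : ∀ q, ∃! r, r ∈ resolventSet p.pB q) {q' : G.Pt} (hq' : p.Rstar q' = q') (q : G.Pt) :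
    p.formK (p.Rstar q - q') (p.Rstar q - q') ≤ p.formK (q - q') (q - q') := by
  have h := reflectedResolvent_pB_le hp hB (reflectedResolvent p.pA q)
    (reflectedResolvent p.pA q')
  change p.formK (p.Rstar q - p.Rstar q') (p.Rstar q - p.Rstar q') ≤ _ at h
  rw [hq'] at h
  -- Monotonicity is needed only at the resolvent value of the fixed point `q'`, which is a zero of
  -- `𝕋`.
  exact h.trans (reflectedResolvent_pA_le hp hA q q'
    (monotoneAt_of_zero_mem_opT hp h1 h4 h5 (zero_mem_opT_of_Rstar_eq_self hp hA hB hq')))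

end Params

/-! ### Borel structure of the space of all `ψ`. -/

instance borelSpace_pt : BorelSpace G.Pt := by
  have h1 : BorelSpace ((G.Edge → G.Profile) × (G.Edge → Fin m → ℝ)) := inferInstance
  have h2 : BorelSpace ((Fin N → Fin m → ℝ) × (G.Edge → G.Profile) × (G.Edge → Fin m → ℝ)) :=
    Prod.borelSpace
  exact Prod.borelSpace

instance secondCountableTopology_pt : SecondCountableTopology G.Pt := by
  have h1 : SecondCountableTopology G.Stack := inferInstance
  have h2 : SecondCountableTopology (G.Edge → G.Profile) := inferInstance
  have h3 : SecondCountableTopology ((G.Edge → G.Profile) × (G.Edge → Fin m → ℝ)) := inferInstance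
  have h4 : SecondCountableTopology (Fin N → Fin m → ℝ) := inferInstance
  have h5 : SecondCountableTopology
    ((Fin N → Fin m → ℝ) × (G.Edge → G.Profile) × (G.Edge → Fin m → ℝ)) := inferInstance
  exact inferInstance

/-! ### The history of the iteration -/

section History

variable {Ω : Type*} {K : ℕ → Fin N → ℕ} {ψ₀ : Ω → G.Pt}
  {ζ : ∀ l i, Fin (K l i) → Ω → (Fin (G.d i) → ℝ)}

theorem history_mono : Monotone (history K ψ₀ ζ) := by
  intro k k' hk
  refine sup_le_sup_left (iSup_le fun l => ?_) _
  exact le_iSup_of_le (Fin.castLE hk l) le_rfl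

theorem history_le [mΩ : MeasurableSpace Ω] (hψ₀ : Measurable ψ₀)
    (hζ : ∀ k i t, Measurable (ζ k i t)) (k : ℕ) : history K ψ₀ ζ k ≤ mΩ :=
  sup_le hψ₀.comap_le (iSup_le fun l => iSup_le fun i => iSup_le fun t => (hζ l i t).comap_le)

end History

end SGNEP

/-! ### Almost sure convergence of the inexact iteration. -/

theorem theorem2 {N m : ℕ} (G : SGNEP.Game.{u} N m) (p : SGNEP.Params G)
    (hp : p.Admissible)
    -- the standing assumptions
    (h1 : SGNEP.ScenarioObjectives G) (h2 : SGNEP.FeasibleSets G)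
    (h3 : ∃ x, G.IsVSGNE x) (h4 : SGNEP.Communicable G)
    (h5 : SGNEP.ConvgMonotone p ∨ SGNEP.ConvgLipschitz p) (h6 : SGNEP.DesignPosDef p)
    -- relaxation sequence
    (γ : ℕ → ℝ) (hγ : ∀ k, γ k ∈ Set.Icc (0 : ℝ) 1)
    (hγsum : Tendsto (fun M => ∑ k ∈ Finset.range M, γ k * (1 - γ k)) atTop atTop)
    -- observed noise samples and the approximation `RA k · s` of the reflected resolvent of `Φ⁻¹𝔸`
    -- that the inexact solver realizes in iteration `k` when it observes the samples `s`
    {Ω : Type*} [MeasurableSpace Ω] (ℙ : Measure Ω) [IsProbabilityMeasure ℙ]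
    (K : ℕ → Fin N → ℕ) (ζ : ∀ k i, Fin (K k i) → Ω → (Fin (G.d i) → ℝ))
    (hζ : ∀ k i t, Measurable (ζ k i t))
    (RA : ∀ k, G.Pt → (∀ i, Fin (K k i) → (Fin (G.d i) → ℝ)) → G.Pt)
    (hRA : ∀ k, Measurable (Function.uncurry (RA k)))
    -- the inexact Douglas–Rachford iteration, `R k ω` being the approximate operator
    (R : ℕ → Ω → G.Pt → G.Pt)
    (hR : ∀ k ω ψ, R k ω ψ =
      SGNEP.reflectedResolvent p.pB (RA k ψ fun i t => ζ k i t ω))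
    (ψ : ℕ → Ω → G.Pt) (hψ0 : Measurable (ψ 0))
    (hψ : ∀ k ω, ψ (k + 1) ω = ψ k ω + γ k • (R k ω (ψ k ω) - ψ k ω))
    -- the iterates are bounded almost surely
    (hbdd : ∀ᵐ ω ∂ℙ, ∃ C : ℝ, ∀ k, p.normK (ψ k ω) ≤ C)
    -- the weighted conditional expectations of the errors are summable almost surely
    (hsum : ∀ᵐ ω ∂ℙ, ∑' k, ENNReal.ofReal (γ k) *
      condLExp (SGNEP.history K (ψ 0) ζ k) ℙ
        (fun ω' => ENNReal.ofReal (p.normK (R k ω' (ψ k ω') - p.Rstar (ψ k ω')))) ω < ∞) :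
    -- the resolvents are single-valued and defined everywhere
    (∀ q, ∃! r, r ∈ SGNEP.resolventSet p.pA q) ∧
    (∀ q, ∃! r, r ∈ SGNEP.resolventSet p.pB q) ∧
    ∀ᵐ ω ∂ℙ,
      (∃ ψfix : G.Pt, p.Rstar ψfix = ψfix ∧ Tendsto (fun k => ψ k ω) atTop (𝓝 ψfix)) ∧
      ∃ ψs : G.Pt,
        Tendsto (fun k => SGNEP.resolvent p.pA (ψ k ω)) atTop (𝓝 ψs) ∧
        0 ∈ p.opT ψs ∧
        ∃ (ys : G.Profile) (lams : Fin m → ℝ),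
          (∀ i, ψs.1 i = ys) ∧ (∀ i, ψs.2.1 i = lams) ∧
          G.IsVSGNE ys ∧ G.IsKKT ys lams := by
  have hA := SGNEP.Params.existsUnique_resolventSet_pA hp h1 h2
  have hB := SGNEP.Params.existsUnique_resolventSet_pB hp h2 h6
  refine ⟨hA, hB, ?_⟩
  have hJA := SGNEP.Params.continuous_resolvent_pA hp h1 h5 h6 hA
  have hRA' := SGNEP.Params.continuous_reflectedResolvent hJA
  have hRB : Continuous (SGNEP.reflectedResolvent p.pB) :=
    SGNEP.Params.continuous_of_formK_le h6 (SGNEP.Params.reflectedResolvent_pB_le hp hB)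
  have hRs : Continuous p.Rstar := hRB.comp hRA'
  obtain ⟨n, e, he, heK⟩ := SGNEP.Params.exists_continuousLinearEquiv h6
  have hψm : ∀ k, Measurable (ψ k) := by
    intro k
    induction k with
    | zero => exact hψ0
    | succ k ih =>
      have hs : Measurable fun ω => R k ω (ψ k ω) := by
        simp only [hR]
        refine hRB.measurable.comp ((hRA k).comp (ih.prodMk ?_))
        exact measurable_pi_lambda _ fun i => measurable_pi_lambda _ fun t => hζ k i t
      have : ψ (k + 1) = fun ω => ψ k ω + γ k • (R k ω (ψ k ω) - ψ k ω) := funext (hψ k)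
      rw [this]
      exact ih.add ((hs.sub ih).const_smul (γ k))
  have hεm : ∀ k, Measurable fun ω =>
      ENNReal.ofReal (p.normK (R k ω (ψ k ω) - p.Rstar (ψ k ω))) := by
    intro k
    have hs : Measurable fun ω => R k ω (ψ k ω) := by
      simp only [hR]
      refine hRB.measurable.comp ((hRA k).comp ((hψm k).prodMk ?_))
      exact measurable_pi_lambda _ fun i => measurable_pi_lambda _ fun t => hζ k i t
    simp only [← heK]
    exact ((e.continuous.norm.measurable).comp
      (hs.sub (hRs.measurable.comp (hψm k)))).ennreal_ofReal
  obtain ⟨x₀, hx₀⟩ := h3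
  obtain ⟨ψ₁, hψ₁⟩ := SGNEP.Params.exists_zero_mem_opT hp h2 h4 hx₀
  obtain ⟨q₀, hq₀⟩ := SGNEP.Params.exists_Rstar_eq_self hp h6 hA hB hψ₁
  -- From here on the argument is deterministic, along one path with summable weighted errors.
  filter_upwards [SGNEP.ae_tsum_lt_top_of_condLExp ℙ _ SGNEP.history_mono
    (SGNEP.history_le hψ0 hζ) _ _ hεm hsum] with ω hω
  have hsummable : Summable fun k =>
      γ k * p.normK (R k ω (ψ k ω) - p.Rstar (ψ k ω)) := by
    have h := ENNReal.summable_toReal hω.ne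
    refine h.congr fun k => ?_
    rw [← ENNReal.ofReal_mul (hγ k).1, ENNReal.toReal_ofReal]
    exact mul_nonneg (hγ k).1 (Real.sqrt_nonneg _)
  obtain ⟨z, hz, hlim⟩ := SGNEP.exists_tendsto_fixedPoint
    (T := fun z => e (p.Rstar (e.symm z))) (x := fun k => e (ψ k ω))
    (e.continuous.comp (hRs.comp e.symm.continuous))
    (fun z hz y => by
      have hz' : p.Rstar (e.symm z) = e.symm z := e.injective (by simpa using hz)
      have h := SGNEP.Params.formK_Rstar_sub_le hp h1 h4 h5 hA hB hz' (e.symm y)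
      rw [← he, ← he, map_sub, map_sub, e.apply_symm_apply, e.apply_symm_apply] at h
      exact (sq_le_sq₀ (norm_nonneg _) (norm_nonneg _)).1 h)
    -- The inexact step differs from the exact one by `γ k` times the operator error, and `e`
    -- carries `normK` to the Euclidean norm.
    ⟨e q₀, by simp [hq₀]⟩ hγ hγsum hsummable (fun k => by
      simp only [e.symm_apply_apply]
      rw [hψ k ω, ← map_sub, ← map_smul, ← map_add, ← map_sub, add_sub_add_left_eq_sub,
        ← smul_sub, sub_sub_sub_cancel_right, map_smul, norm_smul, heK, Real.norm_eq_abs,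
        abs_of_nonneg (hγ k).1])
  have hfix : p.Rstar (e.symm z) = e.symm z := e.injective (by simpa using hz)
  have hψlim : Tendsto (fun k => ψ k ω) atTop (𝓝 (e.symm z)) := by
    simpa [Function.comp_def] using (e.symm.continuous.tendsto z).comp hlim
  have hzero := SGNEP.Params.zero_mem_opT_of_Rstar_eq_self hp hA hB hfix
  exact ⟨⟨_, hfix, hψlim⟩, _, (hJA.tendsto _).comp hψlim, hzero,
    SGNEP.Params.consensus_of_zero_mem_opT hp h4 hzero⟩
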